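/- Let $a,b$ be natural numbers with $b>a\ge 2$. For real $\alpha_1,\alpha_2,\beta_1,\beta_2$ consider the Coxeter–Schläfli matrix $$\mathbb B=\begin{pmatrix}1&-\cos\beta_1&-\cos\beta_2&-\cos\alpha_1\\-\cos\beta_1&1&-\cos\alpha_1&-\cos\alpha_2\\-\cos\beta_2&-\cos\alpha_1&1&-\cos\beta_1\\-\cos\alpha_1&-\cos\alpha_2&-\cos\beta_1&1\end{pmatrix},$$ whose rows and columns $0,1,2,3$ correspond to the faces of a simplex $T$ opposite its vertices $A_0,A_1,A_2,A_3$, so that its off-diagonal entries are minus the cosines of the dihedral angles of $T$. Put $$B_{00}=1-\cos^2\alpha_1-\cos^2\alpha_2-\cos^2\beta_1-2\cos\alpha_1\cos\alpha_2\cos\beta_1,$$ $$B_{11}=1-\cos^2\alpha_1-\cos^2\beta_1-\cos^2\beta_2-2\cos\alpha_1\cos\beta_1\cos\beta_2,$$ $$f_1=B_{00}\sin^2\beta_1-B_{11}\sin^2\alpha_2,\qquad f_2=B_{11}\sin^2\alpha_1-B_{00}\sin^2\beta_2 .$$ Consider the system $$2\alpha_1+\alpha_2=\frac{2\pi}{a},\qquad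 2\beta_1+\beta_2=\frac{2\pi}{b},\qquad f_1=0,\qquad f_2=0. \tag{$*$}$$ A solution $(\alpha_1,\alpha_2,\beta_1,\beta_2)$ of $(*)$ is called proper if $\alpha_1,\alpha_2,\beta_1,\beta_2>0$, the matrix $\mathbb B$ has signature $(+,+,+,-)$ (the simplex is hyperbolic), and each of the four $3\times3$ matrices obtained from $\mathbb B$ by deleting the $i$-th row and the $i$-th column, $i=0,1,2,3$, has signature $(+,+,-)$ (all vertices lie out of the absolute). The simplex $T$ with parameters $a,b$ is said to be hyperbolic with vertices out of the absolute if $(*)$ has a proper solution. Then $T$ is hyperbolic with vertices out of the absolute if and only if $$\Bigl(1+\cos\frac{\pi}{a}\Bigr)\sin\frac{2\pi}{b}>\Bigl(\cos\frac{\pi}{a}+\cos\frac{2\pi}{b}\Bigr)\sin\frac{\pi}{a}.$$ This inequality is equivalent to $f_2\bigl(\frac{\pi}{a},0\bigr)>0$, where $f_2(\alpha_1,\beta_1)$ denotes $f_2$ with $\alpha_2=\frac{2\pi}{a}-2\alpha_1$ and $\beta_2=\frac{2\pi}{b}-2\beta_1$. When it holds, the system $(*)$ has exactly one proper solution. -/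

import Mathlib

noncomputable section

namespace SimplexT

open Real

/-- The four essential dihedral angles of the simplex `T`. -/
@[ext]
structure Angles where
  α₁ : ℝ
  α₂ : ℝ
  β₁ : ℝ
  β₂ : ℝ

/-- The Coxeter–Schläfli (Gram) matrix of the simplex `T`: row and column `i` belong to the face
opposite the vertex `A_i`. -/
def coxeterSchlafli (θ : Angles) : Matrix (Fin 4) (Fin 4) ℝ :=
  !![1, -cos θ.β₁, -cos θ.β₂, -cos θ.α₁;
    -cos θ.β₁, 1, -cos θ.α₁, -cos θ.α₂;
    -cos θ.β₂, -cos θ.α₁, 1, -cos θ.β₁;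
    -cos θ.α₁, -cos θ.α₂, -cos θ.β₁, 1]

/-- The quadratic form `x ↦ xᵀ M x` has positive index of inertia `p` and negative index of
inertia `q`. -/
def HasSignature {n : ℕ} (M : Matrix (Fin n) (Fin n) ℝ) (p q : ℕ) : Prop :=
  sigPos M.toQuadraticForm' = p ∧ sigNeg M.toQuadraticForm' = q

/-- The submatrix obtained by deleting row `i` and column `i`; it belongs to the vertex `A_i`. -/
def vertexMinor (M : Matrix (Fin 4) (Fin 4) ℝ) (i : Fin 4) : Matrix (Fin 3) (Fin 3) ℝ :=
  M.submatrix i.succAbove i.succAbove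

/-- The metric is hyperbolic: signature `(+, +, +, -)`. -/
def IsHyperbolic (M : Matrix (Fin 4) (Fin 4) ℝ) : Prop :=
  HasSignature M 3 1

/-- Every vertex lies out of the absolute: each vertex submatrix has signature `(+, +, -)`. -/
def VerticesOutOfAbsolute (M : Matrix (Fin 4) (Fin 4) ℝ) : Prop :=
  ∀ i, HasSignature (vertexMinor M i) 2 1

/-- The first edge function. -/
def f₁ (θ : Angles) : ℝ :=
  (1 - cos θ.α₁ ^ 2 - cos θ.α₂ ^ 2 - cos θ.β₁ ^ 2
      - 2 * cos θ.α₁ * cos θ.α₂ * cos θ.β₁) * sin θ.β₁ ^ 2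
    - (1 - cos θ.α₁ ^ 2 - cos θ.β₁ ^ 2 - cos θ.β₂ ^ 2
      - 2 * cos θ.α₁ * cos θ.β₁ * cos θ.β₂) * sin θ.α₂ ^ 2

/-- The second edge function. -/
def f₂ (θ : Angles) : ℝ :=
  (1 - cos θ.α₁ ^ 2 - cos θ.β₁ ^ 2 - cos θ.β₂ ^ 2
      - 2 * cos θ.α₁ * cos θ.β₁ * cos θ.β₂) * sin θ.α₁ ^ 2
    - (1 - cos θ.α₁ ^ 2 - cos θ.α₂ ^ 2 - cos θ.β₁ ^ 2
      - 2 * cos θ.α₁ * cos θ.α₂ * cos θ.β₁) * sin θ.β₂ ^ 2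

/-- The angles with given `α₁`, `β₁` and `α₂`, `β₂` determined by the two angle sums. -/
def anglesOf (a b : ℕ) (α₁ β₁ : ℝ) : Angles :=
  ⟨α₁, 2 * π / a - 2 * α₁, β₁, 2 * π / b - 2 * β₁⟩

/-- `θ` solves the system consisting of the two angle sums and the two edge conditions. -/
structure IsSolution (a b : ℕ) (θ : Angles) : Prop where
  sum_α : 2 * θ.α₁ + θ.α₂ = 2 * π / a
  sum_β : 2 * θ.β₁ + θ.β₂ = 2 * π / b
  edge₁ : f₁ θ = 0
  edge₂ : f₂ θ = 0

/-- A proper solution: the dihedral angles are positive, and the simplex with these dihedral angles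
is hyperbolic with all vertices out of the absolute. -/
structure IsProperSolution (a b : ℕ) (θ : Angles) : Prop extends IsSolution a b θ where
  α₁_pos : 0 < θ.α₁
  α₂_pos : 0 < θ.α₂
  β₁_pos : 0 < θ.β₁
  β₂_pos : 0 < θ.β₂
  hyperbolic : IsHyperbolic (coxeterSchlafli θ)
  outer : VerticesOutOfAbsolute (coxeterSchlafli θ)

/-- The simplex `T` with parameters `a`, `b` is hyperbolic with vertices out of the absolute. -/
def RealizableOuter (a b : ℕ) : Prop :=
  ∃ θ, IsProperSolution a b θ

/-- The trigonometric inequality for the parameters. -/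
def MainInequality (a b : ℕ) : Prop :=
  (1 + cos (π / a)) * sin (2 * π / b) > (cos (π / a) + cos (2 * π / b)) * sin (π / a)

end SimplexT

end

/-!
The angle sums leave two free angles. With `x = π / a`, `z = π / b`, `α₁ = 2 u`, `β₁ = 2 v`, the
claim becomes a statement about two equations in the two unknowns `u` and `v`.

*Signatures.* By the spectral theorem a symmetric matrix has negative determinant iff its form is
nondegenerate with odd negative index. A `1` on the diagonal leaves index `1` as the only odd value
for the vertex matrices, and two faces meeting at a real angle do the same for the full matrix;
hence all signature conditions are inequalities for determinants (`isHyperbolic_iff`,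
`verticesOutOfAbsolute_iff`). The determinant of a vertex matrix is minus four times a product of
four cosines, all of which are positive in the region `InRegion`. A product of cosines could
also be positive with two negative factors; only `a = 2` leaves room for this, and there
`sub_lt_pi_div_two_of_edge` and `add_lt_pi_div_two_of_edge` exclude it by estimates.

*Reduction.* An ultra-ideal vertex cuts out a hyperbolic triangle with known angles, and the
equations `f₁ = f₂ = 0` compare sides of two such triangles. Passing from the hyperbolic cosine `c`
of a side to `(c - 1) / (c + 1)` turns both into products of cosines, and their products and
quotients collapse to two relations between sines (`InRegion.edge_iff`): `redEdge₁` and `redEdge₂`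
vanish at `w = u + v`, `δ = u - v`. Monotonicity of tangents then confines the solutions to a small
polygon `InCore`, on which conversely every solution of the two equations is proper
(`isProperSolution_iff`).

*Solving.* The equation `redEdge₂ = 0` reads `cos (2 δ - (x - z)) = curveCos x z w` and is solved
for `δ` by an arccosine, so that proper solutions are the zeros `w` of the single function
`curveEdge x z`, which is `redEdge₁` along this curve. Its derivative is a negative multiple of the
Jacobian `jac` of the two reduced equations. At a common zero, the tangents of all angles involved
are rational functions of four numbers bound by two relations, and an algebraic identity shows
`jac > 0` (`jacPoly_pos`, `InCore.jac_pos`). Hence `curveEdge` decreases through each of its zeros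
and has at most one; it is negative at the right end of the curve. At the left end it is positive if
`x < 2 z`. Otherwise it vanishes there, at the degenerate simplex `α₁ = x`, `β₁ = 0`, and its
derivative is a positive multiple of the difference `mainGap` of the two sides of the main
inequality. So a zero exists if `mainGap > 0` (which is automatic for `x < 2 z`), and none if
`mainGap < 0`. A zero with `mainGap = 0` would leave `curveEdge` positive somewhere, also for a
slightly smaller `z`, for which `mainGap < 0`: a contradiction.
-/

namespace SimplexT
open Real

/-! ### Signatures of symmetric matrices -/

/-- A product is negative iff no factor vanishes and the number of negative factors is odd. -/
theorem prod_neg_iff_odd_ncard {n : ℕ} (w : Fin n → ℝ) :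
    ∏ i, w i < 0 ↔
      {i | 0 < w i}.ncard + {i | w i < 0}.ncard = n ∧ Odd {i | w i < 0}.ncard := by
  classical
  have hcard : {i | 0 < w i}.ncard + {i | w i < 0}.ncard = {i | w i ≠ 0}.ncard := by
    rw [← Set.ncard_union_eq]
    · congr 1
      ext i
      simp [lt_or_lt_iff_ne, ne_comm]
    · rw [Set.disjoint_left]
      intro i h1 h2
      exact lt_asymm (Set.mem_ofPred.1 h1) (Set.mem_ofPred.1 h2)
  have hprod : ∏ i, w i = (∏ i, |w i|) * (-1) ^ {i | w i < 0}.ncard := by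
    have h : ∀ i, w i = |w i| * (if w i < 0 then -1 else 1) := by
      intro i
      split_ifs with hi
      · rw [abs_of_neg hi]; ring
      · rw [abs_of_nonneg (not_lt.1 hi)]; ring
    have hs : {i | w i < 0}.ncard = (Finset.univ.filter fun i => w i < 0).card := by
      rw [← Set.ncard_coe_finset]; congr 1; ext; simp
    conv_lhs => rw [Finset.prod_congr rfl fun i _ => h i]
    rw [Finset.prod_mul_distrib, hs, Finset.prod_ite]
    simp
  rw [hcard]
  by_cases h0 : ∃ i, w i = 0
  · obtain ⟨i, hi⟩ := h0
    have h1 : {i | w i ≠ 0}.ncard < n := by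
      have : {i | w i ≠ 0} ⊂ Set.univ := by
        rw [Set.ssubset_univ_iff]
        intro h
        exact (h ▸ Set.mem_univ i : i ∈ {i | w i ≠ 0}) hi
      simpa using Set.ncard_lt_ncard this
    rw [Finset.prod_eq_zero (Finset.mem_univ i) hi]
    simp [h1.ne]
  · push Not at h0
    have h1 : {i | w i ≠ 0}.ncard = n := by
      have : {i | w i ≠ 0} = Set.univ := Set.eq_univ_of_forall h0
      rw [this]; simp
    have hpos : 0 < ∏ i, |w i| := Finset.prod_pos fun i _ => abs_pos.2 (h0 i)
    rw [hprod, h1]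
    rcases Nat.even_or_odd {i | w i < 0}.ncard with he | ho
    · rw [he.neg_one_pow, mul_one]
      exact iff_of_false hpos.not_gt (fun h => Nat.not_odd_iff_even.2 he h.2)
    · simp [ho.neg_one_pow, hpos, ho]

/-- By the spectral theorem, the quadratic form of a symmetric real matrix is equivalent to the sum
of squares weighted by the eigenvalues. -/
theorem toQuadraticForm'_equivalent_eigenvalues {n : ℕ} {M : Matrix (Fin n) (Fin n) ℝ}
    (hM : M.IsHermitian) :
    M.toQuadraticForm'.Equivalent (QuadraticMap.weightedSumSquares ℝ hM.eigenvalues) := by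
  refine QuadraticMap.Equivalent.symm
    ⟨⟨Matrix.UnitaryGroup.toLinearEquiv hM.eigenvectorUnitary, fun x => ?_⟩⟩
  have h := hM.conjStarAlgAut_star_eigenvectorUnitary
  rw [Unitary.conjStarAlgAut_star_apply] at h
  set U : Matrix (Fin n) (Fin n) ℝ := hM.eigenvectorUnitary.1 with hU
  have hx : (Matrix.UnitaryGroup.toLinearEquiv hM.eigenvectorUnitary) x = U.mulVec x := rfl
  have hq : ∀ y, M.toQuadraticForm' y = y ⬝ᵥ M.mulVec y := by
    intro y
    simp [Matrix.toQuadraticForm', Matrix.toLinearMap₂'_apply']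
  change M.toQuadraticForm' ((Matrix.UnitaryGroup.toLinearEquiv hM.eigenvectorUnitary) x) = _
  rw [hx, hq, QuadraticMap.weightedSumSquares_apply]
  have e : U.mulVec x ⬝ᵥ M.mulVec (U.mulVec x) = x ⬝ᵥ ((star U * M * U).mulVec x) := by
    rw [← Matrix.mulVec_mulVec, ← Matrix.mulVec_mulVec, Matrix.dotProduct_mulVec x (star U),
      Matrix.star_eq_conjTranspose, Matrix.conjTranspose_eq_transpose_of_trivial,
      Matrix.vecMul_transpose]
  rw [e, h]
  simp only [Matrix.mulVec_diagonal, dotProduct, smul_eq_mul]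
  refine Finset.sum_congr rfl fun i _ => ?_
  simp
  ring

/-- A symmetric real matrix has negative determinant iff its form is nondegenerate with odd
negative index. -/
theorem det_neg_iff {n : ℕ} {M : Matrix (Fin n) (Fin n) ℝ} (hM : M.IsHermitian) :
    M.det < 0 ↔
      sigPos M.toQuadraticForm' + sigNeg M.toQuadraticForm' = n ∧
        Odd (sigNeg M.toQuadraticForm') := by
  have e := toQuadraticForm'_equivalent_eigenvalues hM
  rw [QuadraticForm.sigPos_of_equiv_weightedSumSquares e,
    QuadraticForm.sigNeg_of_equiv_weightedSumSquares e, hM.det_eq_prod_eigenvalues]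
  exact prod_neg_iff_odd_ncard hM.eigenvalues

/-- A coordinate subspace on which the form is nonnegative bounds the negative index. -/
theorem sigNeg_add_ncard_le {n : ℕ} (M : Matrix (Fin n) (Fin n) ℝ) (s : Set (Fin n))
    (h : ∀ x : Fin n → ℝ, (∀ i ∉ s, x i = 0) → 0 ≤ M.toQuadraticForm' x) :
    sigNeg M.toQuadraticForm' + s.ncard ≤ n := by
  have := QuadraticForm.sigPos_add_finrank_le_of_nonpos (Q := -M.toQuadraticForm')
    (V := Pi.spanSubset ℝ s) (fun x hx => by
      simpa using h x (Pi.mem_spanSubset_iff.1 hx))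
  simpa [Pi.dim_spanSubset] using this

/-- A nonnegative diagonal entry rules out the negative index `3`. -/
theorem hasSignature_two_one_iff {M : Matrix (Fin 3) (Fin 3) ℝ} (hM : M.IsHermitian)
    (h0 : 0 ≤ M 0 0) : HasSignature M 2 1 ↔ M.det < 0 := by
  rw [det_neg_iff hM]
  constructor
  · rintro ⟨h1, h2⟩
    rw [h1, h2]
    exact ⟨rfl, odd_one⟩
  · rintro ⟨h1, h2⟩
    have h3 := sigNeg_add_ncard_le M {0} fun x hx => by
      have h1 := hx 1 (by simp)
      have h2 := hx 2 (by simp)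
      simp [Matrix.toQuadraticForm', Matrix.toLinearMap₂'_apply', Matrix.mulVec, dotProduct,
        Fin.sum_univ_succ, h1, h2]
      nlinarith [mul_self_nonneg (x 0), mul_nonneg h0 (mul_self_nonneg (x 0))]
    simp only [Set.ncard_singleton] at h3
    obtain ⟨r, hr⟩ := h2
    constructor <;> lia

/-- A positive semidefinite `2 × 2` block rules out the negative index `3`. -/
theorem hasSignature_three_one_iff {M : Matrix (Fin 4) (Fin 4) ℝ} (hM : M.IsHermitian)
    (h0 : M 0 0 = 1) (h1 : M 1 1 = 1) (h01 : |M 0 1| ≤ 1) :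
    HasSignature M 3 1 ↔ M.det < 0 := by
  rw [det_neg_iff hM]
  constructor
  · rintro ⟨h1, h2⟩
    rw [h1, h2]
    exact ⟨rfl, odd_one⟩
  · rintro ⟨h2, h3⟩
    have h10 : M 1 0 = M 0 1 := by simpa using (hM.apply 0 1)
    have h4 := sigNeg_add_ncard_le M {0, 1} fun x hx => by
      have e2 := hx 2 (by simp)
      have e3 := hx 3 (by simp)
      have := abs_le.1 h01
      have e : M.toQuadraticForm' x = x 0 ^ 2 + 2 * M 0 1 * x 0 * x 1 + x 1 ^ 2 := by
        simp only [Matrix.toQuadraticForm', LinearMap.BilinMap.toQuadraticMap_apply,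
          Matrix.toLinearMap₂'_apply', Matrix.mulVec, dotProduct, Fin.sum_univ_four, h0, h1, h10,
          e2, e3]
        ring
      rw [e]
      nlinarith [mul_nonneg (by linarith : 0 ≤ 1 + M 0 1) (sq_nonneg (x 0 + x 1)),
        mul_nonneg (by linarith : 0 ≤ 1 - M 0 1) (sq_nonneg (x 0 - x 1))]
    rw [Set.ncard_pair (by decide)] at h4
    obtain ⟨r, hr⟩ := h3
    constructor <;> lia

/-! ### The signature conditions as determinant inequalities -/

/-- The determinant of the Gram matrix of a triangle with angles whose cosines are `p`, `q`, `r`. -/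
def triangleDet (p q r : ℝ) : ℝ :=
  1 - p ^ 2 - q ^ 2 - r ^ 2 - 2 * p * q * r

theorem coxeterSchlafli_isHermitian (θ : Angles) : (coxeterSchlafli θ).IsHermitian := by
  ext i j
  fin_cases i <;> fin_cases j <;> simp [coxeterSchlafli]

/-- The involution exchanging `A₀ ↔ A₂` and `A₁ ↔ A₃` splits the Coxeter–Schläfli form into two
binary forms, whence the factorization of the determinant. -/
theorem det_coxeterSchlafli (θ : Angles) :
    (coxeterSchlafli θ).det =
      ((1 - cos θ.β₂) * (1 - cos θ.α₂) - (cos θ.α₁ + cos θ.β₁) ^ 2) *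
        ((1 + cos θ.β₂) * (1 + cos θ.α₂) - (cos θ.α₁ - cos θ.β₁) ^ 2) := by
  rw [Matrix.det_succ_row_zero]
  simp [Fin.sum_univ_four, Matrix.det_fin_three, coxeterSchlafli, Fin.succAbove]
  ring

theorem det_vertexMinor (θ : Angles) (i : Fin 4) :
    (vertexMinor (coxeterSchlafli θ) i).det =
      if i = 0 ∨ i = 2 then triangleDet (cos θ.α₁) (cos θ.α₂) (cos θ.β₁)
      else triangleDet (cos θ.α₁) (cos θ.β₁) (cos θ.β₂) := by
  fin_cases i <;>
  simp [vertexMinor, Matrix.det_fin_three, coxeterSchlafli, Fin.succAbove, triangleDet] <;>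
  ring

theorem isHyperbolic_iff (θ : Angles) :
    IsHyperbolic (coxeterSchlafli θ) ↔ (coxeterSchlafli θ).det < 0 :=
  hasSignature_three_one_iff (coxeterSchlafli_isHermitian θ) (by simp [coxeterSchlafli])
    (by simp [coxeterSchlafli]) (by simpa [coxeterSchlafli] using abs_cos_le_one _)

theorem verticesOutOfAbsolute_iff (θ : Angles) :
    VerticesOutOfAbsolute (coxeterSchlafli θ) ↔
      triangleDet (cos θ.α₁) (cos θ.α₂) (cos θ.β₁) < 0 ∧
        triangleDet (cos θ.α₁) (cos θ.β₁) (cos θ.β₂) < 0 := by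
  have h : ∀ i, HasSignature (vertexMinor (coxeterSchlafli θ) i) 2 1 ↔
      (vertexMinor (coxeterSchlafli θ) i).det < 0 := fun i =>
    hasSignature_two_one_iff ((coxeterSchlafli_isHermitian θ).submatrix _) (by
      fin_cases i <;> simp [vertexMinor, coxeterSchlafli, Fin.succAbove])
  unfold VerticesOutOfAbsolute
  simp only [h, det_vertexMinor, Fin.forall_fin_succ]
  simp
  tauto

/-! ### Trigonometric factorizations -/

theorem cos_add_cos_mul_cos_sub (p q r : ℝ) :
    cos (2 * p) + cos (2 * q) * cos (2 * r) - sin (2 * q) * sin (2 * r) =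
      2 * cos (p + q + r) * cos (p - q - r) := by
  rw [two_mul_cos_mul_cos, show p + q + r - (p - q - r) = 2 * q + 2 * r by ring,
    show p + q + r + (p - q - r) = 2 * p by ring, cos_add (2 * q)]
  ring

theorem cos_add_cos_mul_cos_add (p q r : ℝ) :
    cos (2 * p) + cos (2 * q) * cos (2 * r) + sin (2 * q) * sin (2 * r) =
      2 * cos (p + q - r) * cos (p - q + r) := by
  have := cos_add_cos_mul_cos_sub p q (-r)
  simp only [mul_neg, cos_neg, sin_neg, sub_neg_eq_add, ← sub_eq_add_neg] at this
  exact this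

/-- With `c = (cos p + cos q cos r) / (sin q sin r)`, the hyperbolic cosine of the side opposite to
the angle `p`, the right-hand side is `sin² q sin² r (1 - c²)`. -/
theorem triangleDet_eq_sin_sub (p q r : ℝ) :
    triangleDet (cos p) (cos q) (cos r) =
      sin q ^ 2 * sin r ^ 2 - (cos p + cos q * cos r) ^ 2 := by
  rw [sin_sq, sin_sq, triangleDet]; ring

theorem triangleDet_comm (p q r : ℝ) : triangleDet p q r = triangleDet q p r := by
  unfold triangleDet; ring

theorem triangleDet_eq_prod_cos (p q r : ℝ) :
    triangleDet (cos (2 * p)) (cos (2 * q)) (cos (2 * r)) =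
      -4 * (cos (p + q + r) * cos (p - q - r) * (cos (p + q - r) * cos (p - q + r))) := by
  have h1 := cos_add_cos_mul_cos_sub p q r
  have h2 := cos_add_cos_mul_cos_add p q r
  rw [triangleDet_eq_sin_sub]
  calc _ = -((cos (2 * p) + cos (2 * q) * cos (2 * r) - sin (2 * q) * sin (2 * r)) *
      (cos (2 * p) + cos (2 * q) * cos (2 * r) + sin (2 * q) * sin (2 * r))) := by ring
    _ = _ := by rw [h1, h2]; ring

theorem f₂_eq (θ : Angles) :
    f₂ θ = sin θ.β₂ ^ 2 * (cos θ.α₂ + cos θ.α₁ * cos θ.β₁) ^ 2 -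
      sin θ.α₁ ^ 2 * (cos θ.α₁ + cos θ.β₁ * cos θ.β₂) ^ 2 := by
  simp only [f₂, sin_sq]; ring

theorem f₁_eq (θ : Angles) :
    f₁ θ = sin θ.α₂ ^ 2 * (cos θ.β₂ + cos θ.α₁ * cos θ.β₁) ^ 2 -
      sin θ.β₁ ^ 2 * (cos θ.β₁ + cos θ.α₁ * cos θ.α₂) ^ 2 := by
  simp only [f₁, sin_sq]; ring

/-! ### Reduction of the edge conditions to two sine equations -/

/-- The dihedral angles in terms of `u = α₁ / 2` and `v = β₁ / 2`, with the angle sums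
`2 α₁ + α₂ = 2 x` and `2 β₁ + β₂ = 2 z` built in. -/
def halfAngles (x z u v : ℝ) : Angles :=
  ⟨2 * u, 2 * (x - 2 * u), 2 * v, 2 * (z - 2 * v)⟩

/-- The first reduced edge function, in the variables `w = (α₁ + β₁) / 2` and `δ = (α₁ - β₁) / 2`;
the parameters are `S = π / a + π / b` and `D = π / a - π / b`. -/
noncomputable def redEdge₁ (S D w δ : ℝ) : ℝ :=
  sin (3 * δ - D) * sin w - sin (S - w) * sin δ

/-- The second reduced edge function, in the variables and parameters of `redEdge₁`. -/
noncomputable def redEdge₂ (S D w δ : ℝ) : ℝ :=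
  sin (3 * w - S) * sin w - sin (D - δ) * sin δ

theorem redEdge₁_eq_cos (x z u v : ℝ) :
    redEdge₁ (x + z) (x - z) (u + v) (u - v) =
      cos (x - u + v) * cos (z + u - 3 * v) - cos (x - 3 * u + v) * cos (z + u - v) := by
  have h1 := two_mul_cos_mul_cos (x - u + v) (z + u - 3 * v)
  have h2 := two_mul_cos_mul_cos (x - 3 * u + v) (z + u - v)
  have h3 := two_mul_sin_mul_sin (3 * (u - v) - (x - z)) (u + v)
  have h4 := two_mul_sin_mul_sin (x + z - (u + v)) (u - v)
  rw [show x - u + v - (z + u - 3 * v) = -(3 * (u - v) - (x - z) - (u + v)) by ring, cos_neg,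
    show x - u + v + (z + u - 3 * v) = x + z - (u + v) + (u - v) by ring] at h1
  rw [show x - 3 * u + v - (z + u - v) = -(3 * (u - v) - (x - z) + (u + v)) by ring, cos_neg,
    show x - 3 * u + v + (z + u - v) = x + z - (u + v) - (u - v) by ring] at h2
  unfold redEdge₁
  linarith

theorem redEdge₂_eq_cos (x z u v : ℝ) :
    redEdge₂ (x + z) (x - z) (u + v) (u - v) =
      cos (x - u - v) * cos (z - u - v) - cos (x - 3 * u - v) * cos (z - u - 3 * v) := by
  have h1 := two_mul_cos_mul_cos (x - u - v) (z - u - v)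
  have h2 := two_mul_cos_mul_cos (x - 3 * u - v) (z - u - 3 * v)
  have h3 := two_mul_sin_mul_sin (3 * (u + v) - (x + z)) (u + v)
  have h4 := two_mul_sin_mul_sin (x - z - (u - v)) (u - v)
  rw [show x - u - v - (z - u - v) = x - z - (u - v) + (u - v) by ring,
    show x - u - v + (z - u - v) = -(3 * (u + v) - (x + z) - (u + v)) by ring, cos_neg] at h1
  rw [show x - 3 * u - v - (z - u - 3 * v) = x - z - (u - v) - (u - v) by ring,
    show x - 3 * u - v + (z - u - 3 * v) = -(3 * (u + v) - (x + z) + (u + v)) by ring,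
    cos_neg] at h2
  unfold redEdge₂
  linarith

/-- The region of half-angles `u`, `v` that make the dihedral angles positive and the two vertex
triangles hyperbolic. -/
structure InRegion (x z u v : ℝ) : Prop where
  u_pos : 0 < u
  u_lt : 2 * u < x
  v_pos : 0 < v
  v_lt : 2 * v < z
  x_le : x ≤ π / 2
  z_le : z ≤ π / 2
  alpha_lt : x - u + v < π / 2
  beta_lt : z + u - v < π / 2

namespace InRegion

variable {x z u v : ℝ}

theorem cos_pos₁ (h : InRegion x z u v) : 0 < cos (x - u + v) :=
  cos_pos_of_mem_Ioo ⟨by linarith [h.u_pos, h.u_lt, h.v_pos, pi_pos], h.alpha_lt⟩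

theorem cos_pos₂ (h : InRegion x z u v) : 0 < cos (x - 3 * u - v) :=
  cos_pos_of_mem_Ioo ⟨by linarith [h.u_lt, h.v_lt, h.x_le, h.z_le],
    by linarith [h.u_pos, h.v_pos, h.x_le]⟩

theorem cos_pos₃ (h : InRegion x z u v) : 0 < cos (x - u - v) :=
  cos_pos_of_mem_Ioo ⟨by linarith [h.u_pos, h.u_lt, h.v_pos, h.v_lt, h.x_le, h.z_le, pi_pos],
    by linarith [h.u_pos, h.v_pos, h.x_le]⟩

theorem cos_pos₄ (h : InRegion x z u v) : 0 < cos (x - 3 * u + v) :=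
  cos_pos_of_mem_Ioo ⟨by linarith [h.u_lt, h.v_pos, h.x_le, h.u_pos, pi_pos],
    by linarith [h.alpha_lt, h.u_pos]⟩

theorem cos_pos₅ (h : InRegion x z u v) : 0 < cos (z + u - v) :=
  cos_pos_of_mem_Ioo ⟨by linarith [h.u_pos, h.v_lt, h.v_pos, pi_pos], h.beta_lt⟩

theorem cos_pos₆ (h : InRegion x z u v) : 0 < cos (z - u - 3 * v) :=
  cos_pos_of_mem_Ioo ⟨by linarith [h.u_lt, h.v_lt, h.x_le, h.z_le],
    by linarith [h.u_pos, h.v_pos, h.z_le]⟩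

theorem cos_pos₇ (h : InRegion x z u v) : 0 < cos (z + u - 3 * v) :=
  cos_pos_of_mem_Ioo ⟨by linarith [h.u_pos, h.v_lt, h.v_pos, h.z_le, pi_pos],
    by linarith [h.beta_lt, h.v_pos]⟩

theorem cos_pos₈ (h : InRegion x z u v) : 0 < cos (z - u - v) :=
  cos_pos_of_mem_Ioo ⟨by linarith [h.u_pos, h.u_lt, h.v_pos, h.v_lt, h.x_le, h.z_le, pi_pos],
    by linarith [h.u_pos, h.v_pos, h.z_le]⟩

theorem sin_pos_u (h : InRegion x z u v) : 0 < sin (2 * u) :=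
  sin_pos_of_pos_of_lt_pi (by linarith [h.u_pos]) (by linarith [h.u_lt, h.x_le, pi_pos])

theorem sin_pos_v (h : InRegion x z u v) : 0 < sin (2 * v) :=
  sin_pos_of_pos_of_lt_pi (by linarith [h.v_pos]) (by linarith [h.v_lt, h.z_le, pi_pos])

theorem sin_pos_α₂ (h : InRegion x z u v) : 0 < sin (2 * (x - 2 * u)) :=
  sin_pos_of_pos_of_lt_pi (by linarith [h.u_lt]) (by linarith [h.u_pos, h.x_le])

theorem sin_pos_β₂ (h : InRegion x z u v) : 0 < sin (2 * (z - 2 * v)) :=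
  sin_pos_of_pos_of_lt_pi (by linarith [h.v_lt]) (by linarith [h.v_pos, h.z_le])

theorem triangleDet_α_neg (h : InRegion x z u v) :
    triangleDet (cos (2 * u)) (cos (2 * (x - 2 * u))) (cos (2 * v)) < 0 := by
  rw [triangleDet_comm, triangleDet_eq_prod_cos, show x - 2 * u + u + v = x - u + v by ring,
    show x - 2 * u - u - v = x - 3 * u - v by ring, show x - 2 * u + u - v = x - u - v by ring,
    show x - 2 * u - u + v = x - 3 * u + v by ring]
  have := mul_pos (mul_pos h.cos_pos₁ h.cos_pos₂) (mul_pos h.cos_pos₃ h.cos_pos₄)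
  linarith

theorem triangleDet_β_neg (h : InRegion x z u v) :
    triangleDet (cos (2 * u)) (cos (2 * v)) (cos (2 * (z - 2 * v))) < 0 := by
  rw [triangleDet_eq_prod_cos, show u + v + (z - 2 * v) = z + u - v by ring,
    show u - v - (z - 2 * v) = -(z - u - v) by ring,
    show u + v - (z - 2 * v) = -(z - u - 3 * v) by ring,
    show u - v + (z - 2 * v) = z + u - 3 * v by ring, cos_neg, cos_neg]
  have := mul_pos (mul_pos h.cos_pos₅ h.cos_pos₆) (mul_pos h.cos_pos₇ h.cos_pos₈)
  linarith

/-- In the region `f₂ = 0` says that a side of one vertex triangle equals a side of the other. The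
equation on the right compares the quotients `(c - 1) / (c + 1)` of their hyperbolic cosines `c`,
where numerator and denominator are products of cosines. -/
theorem f₂_eq_zero_iff (h : InRegion x z u v) :
    f₂ (halfAngles x z u v) = 0 ↔
      cos (x - u + v) * cos (x - 3 * u - v) * (cos (z - u - 3 * v) * cos (z + u - 3 * v)) =
        cos (x - u - v) * cos (x - 3 * u + v) * (cos (z + u - v) * cos (z - u - v)) := by
  have a1 := cos_add_cos_mul_cos_sub (x - 2 * u) u v
  have a2 := cos_add_cos_mul_cos_add (x - 2 * u) u v
  have b1 := cos_add_cos_mul_cos_sub u v (z - 2 * v)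
  have b2 := cos_add_cos_mul_cos_add u v (z - 2 * v)
  rw [show x - 2 * u + u + v = x - u + v by ring,
    show x - 2 * u - u - v = x - 3 * u - v by ring] at a1
  rw [show x - 2 * u + u - v = x - u - v by ring,
    show x - 2 * u - u + v = x - 3 * u + v by ring] at a2
  rw [show u + v + (z - 2 * v) = z + u - v by ring,
    show u - v - (z - 2 * v) = -(z - u - v) by ring, cos_neg] at b1
  rw [show u + v - (z - 2 * v) = -(z - u - 3 * v) by ring,
    show u - v + (z - 2 * v) = z + u - 3 * v by ring, cos_neg] at b2
  have su := h.sin_pos_u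
  have sv := h.sin_pos_v
  have sB := h.sin_pos_β₂
  rw [f₂_eq]
  simp only [halfAngles]
  set P := cos (2 * (x - 2 * u)) + cos (2 * u) * cos (2 * v) with hP
  set Q := cos (2 * u) + cos (2 * v) * cos (2 * (z - 2 * v)) with hQ
  have hPpos : 0 < P := by
    have := mul_pos h.cos_pos₁ h.cos_pos₂
    have := mul_pos su sv
    linarith
  have hQpos : 0 < Q := by
    have := mul_pos h.cos_pos₅ h.cos_pos₈
    have := mul_pos sv sB
    linarith
  have key : (P - sin (2 * u) * sin (2 * v)) * (Q + sin (2 * v) * sin (2 * (z - 2 * v))) -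
      (P + sin (2 * u) * sin (2 * v)) * (Q - sin (2 * v) * sin (2 * (z - 2 * v))) =
      2 * sin (2 * v) * (sin (2 * (z - 2 * v)) * P - sin (2 * u) * Q) := by ring
  rw [a1, a2, b1, b2] at key
  have e1 : sin (2 * (z - 2 * v)) ^ 2 * P ^ 2 - sin (2 * u) ^ 2 * Q ^ 2 = 0 ↔
      sin (2 * (z - 2 * v)) * P = sin (2 * u) * Q := by
    rw [← mul_pow, ← mul_pow, sub_eq_zero]
    exact pow_left_inj₀ (mul_pos sB hPpos).le (mul_pos su hQpos).le two_ne_zero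
  rw [e1]
  constructor
  · intro e
    rw [e] at key
    linarith
  · intro e
    have : 2 * sin (2 * v) * (sin (2 * (z - 2 * v)) * P - sin (2 * u) * Q) = 0 := by
      linarith
    have := (mul_eq_zero.1 this).resolve_left (by positivity)
    linarith

/-- The analogue of `f₂_eq_zero_iff` for another pair of sides. -/
theorem f₁_eq_zero_iff (h : InRegion x z u v) :
    f₁ (halfAngles x z u v) = 0 ↔
      cos (x - u + v) * cos (x - u - v) * (cos (z + u - 3 * v) * cos (z - u - v)) =
        cos (x - 3 * u - v) * cos (x - 3 * u + v) * (cos (z + u - v) * cos (z - u - 3 * v)) := by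
  have a1 := cos_add_cos_mul_cos_sub v u (x - 2 * u)
  have a2 := cos_add_cos_mul_cos_add v u (x - 2 * u)
  have b1 := cos_add_cos_mul_cos_sub (z - 2 * v) u v
  have b2 := cos_add_cos_mul_cos_add (z - 2 * v) u v
  rw [show v + u + (x - 2 * u) = x - u + v by ring,
    show v - u - (x - 2 * u) = -(x - u - v) by ring, cos_neg] at a1
  rw [show v + u - (x - 2 * u) = -(x - 3 * u - v) by ring,
    show v - u + (x - 2 * u) = x - 3 * u + v by ring, cos_neg] at a2
  rw [show z - 2 * v + u + v = z + u - v by ring,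
    show z - 2 * v - u - v = z - u - 3 * v by ring] at b1
  rw [show z - 2 * v + u - v = z + u - 3 * v by ring,
    show z - 2 * v - u + v = z - u - v by ring] at b2
  have su := h.sin_pos_u
  have sv := h.sin_pos_v
  have sA := h.sin_pos_α₂
  rw [f₁_eq]
  simp only [halfAngles]
  set P := cos (2 * v) + cos (2 * u) * cos (2 * (x - 2 * u)) with hP
  set Q := cos (2 * (z - 2 * v)) + cos (2 * u) * cos (2 * v) with hQ
  have hPpos : 0 < P := by
    have := mul_pos h.cos_pos₁ h.cos_pos₃
    have := mul_pos su sA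
    linarith
  have hQpos : 0 < Q := by
    have := mul_pos h.cos_pos₅ h.cos_pos₆
    have := mul_pos su sv
    linarith
  have key : (P - sin (2 * u) * sin (2 * (x - 2 * u))) * (Q + sin (2 * u) * sin (2 * v)) -
      (P + sin (2 * u) * sin (2 * (x - 2 * u))) * (Q - sin (2 * u) * sin (2 * v)) =
      2 * sin (2 * u) * (sin (2 * v) * P - sin (2 * (x - 2 * u)) * Q) := by ring
  rw [a1, a2, b1, b2] at key
  have e1 : sin (2 * (x - 2 * u)) ^ 2 * Q ^ 2 - sin (2 * v) ^ 2 * P ^ 2 = 0 ↔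
      sin (2 * (x - 2 * u)) * Q = sin (2 * v) * P := by
    rw [← mul_pow, ← mul_pow, sub_eq_zero]
    exact pow_left_inj₀ (mul_pos sA hQpos).le (mul_pos sv hPpos).le two_ne_zero
  rw [e1]
  constructor
  · intro e
    rw [e] at key
    linarith
  · intro e
    have : 2 * sin (2 * u) * (sin (2 * v) * P - sin (2 * (x - 2 * u)) * Q) = 0 := by
      linarith
    have := (mul_eq_zero.1 this).resolve_left (by positivity)
    linarith

/-- In the region the edge conditions are equivalent to the vanishing of the reduced edge
functions: the product and the quotient of the two side comparisons are perfect squares, as in the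
derivation of Napier's analogies. -/
theorem edge_iff (h : InRegion x z u v) :
    f₁ (halfAngles x z u v) = 0 ∧ f₂ (halfAngles x z u v) = 0 ↔
      redEdge₁ (x + z) (x - z) (u + v) (u - v) = 0 ∧
        redEdge₂ (x + z) (x - z) (u + v) (u - v) = 0 := by
  rw [h.f₁_eq_zero_iff, h.f₂_eq_zero_iff, redEdge₁_eq_cos, redEdge₂_eq_cos, sub_eq_zero,
    sub_eq_zero]
  have c1 := h.cos_pos₁
  have c2 := h.cos_pos₂
  have c3 := h.cos_pos₃
  have c4 := h.cos_pos₄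
  have c5 := h.cos_pos₅
  have c6 := h.cos_pos₆
  have c7 := h.cos_pos₇
  have c8 := h.cos_pos₈
  generalize cos (x - u + v) = C1 at *
  generalize cos (x - 3 * u - v) = C2 at *
  generalize cos (x - u - v) = C3 at *
  generalize cos (x - 3 * u + v) = C4 at *
  generalize cos (z + u - v) = C5 at *
  generalize cos (z - u - 3 * v) = C6 at *
  generalize cos (z + u - 3 * v) = C7 at *
  generalize cos (z - u - v) = C8 at *
  constructor
  · rintro ⟨e1, e2⟩
    constructor
    · have e : (C1 * C7) ^ 2 * (C2 * C3 * C6 * C8) = (C4 * C5) ^ 2 * (C2 * C3 * C6 * C8) := by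
        linear_combination C1 * C2 * (C6 * C7) * e1 + C2 * C4 * (C5 * C6) * e2
      exact (pow_left_inj₀ (mul_pos c1 c7).le (mul_pos c4 c5).le two_ne_zero).1
        (mul_right_cancel₀ (by positivity) e)
    · have e : (C3 * C8) ^ 2 * (C1 * C4 * C5 * C7) = (C2 * C6) ^ 2 * (C1 * C4 * C5 * C7) := by
        linear_combination C3 * C4 * (C5 * C8) * e1 - C2 * C4 * (C5 * C6) * e2
      exact (pow_left_inj₀ (mul_pos c3 c8).le (mul_pos c2 c6).le two_ne_zero).1
        (mul_right_cancel₀ (by positivity) e)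
  · rintro ⟨e1, e2⟩
    constructor
    · linear_combination C3 * C8 * e1 + C4 * C5 * e2
    · linear_combination C2 * C6 * e1 - C4 * C5 * e2

end InRegion

/-! ### Proper solutions have hyperbolic vertex triangles -/

theorem one_sub_cos_two_mul_le {A t : ℝ} (hA : 0 ≤ A) (ht : 0 ≤ t) (h : A + t ≤ π / 2) :
    1 - cos (2 * A) ≤ 2 * cos t ^ 2 := by
  have h1 : sin A ≤ cos t := by
    rw [← sin_pi_div_two_sub t]
    exact sin_le_sin_of_le_of_le_pi_div_two (by linarith [pi_pos]) (by linarith) (by linarith)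
  have h0 : 0 ≤ sin A := sin_nonneg_of_nonneg_of_le_pi hA (by linarith [pi_pos])
  have h2 : 1 - cos (2 * A) = 2 * sin A ^ 2 := by rw [sin_sq_eq_half_sub]; ring
  rw [h2]
  nlinarith

/-- The part of the Coxeter–Schläfli form symmetric under the involution of `det_coxeterSchlafli` is
indefinite for all angles in question. -/
theorem symmetric_part_neg {x z u v : ℝ} (hu : 0 < u) (hu' : 2 * u < x) (hx : x ≤ π / 2)
    (hv : 0 < v) (hv' : 2 * v < z) (hz : z ≤ π / 2) :
    (1 - cos (2 * (z - 2 * v))) * (1 - cos (2 * (x - 2 * u))) -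
      (cos (2 * u) + cos (2 * v)) ^ 2 < 0 := by
  have h1 := one_sub_cos_two_mul_le (A := z - 2 * v) (t := 2 * v) (by linarith) (by linarith)
    (by linarith)
  have h2 := one_sub_cos_two_mul_le (A := x - 2 * u) (t := 2 * u) (by linarith) (by linarith)
    (by linarith)
  have hX : 0 < cos (2 * u) := cos_pos_of_mem_Ioo ⟨by linarith, by linarith⟩
  have hY : 0 < cos (2 * v) := cos_pos_of_mem_Ioo ⟨by linarith, by linarith⟩
  have hX1 : cos (2 * u) < 1 := by
    rw [← cos_zero]
    exact cos_lt_cos_of_nonneg_of_le_pi le_rfl (by linarith [pi_pos]) (by linarith)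
  have hY1 : cos (2 * v) ≤ 1 := cos_le_one _
  have h3 : (1 - cos (2 * (z - 2 * v))) * (1 - cos (2 * (x - 2 * u))) ≤
      (2 * cos (2 * v) ^ 2) * (2 * cos (2 * u) ^ 2) :=
    mul_le_mul h1 h2 (by linarith [cos_le_one (2 * (x - 2 * u))]) (by positivity)
  have h4 : 2 * (cos (2 * u) * cos (2 * v)) < cos (2 * u) + cos (2 * v) := by nlinarith
  have h5 : (2 * (cos (2 * u) * cos (2 * v))) ^ 2 < (cos (2 * u) + cos (2 * v)) ^ 2 :=
    pow_lt_pow_left₀ h4 (by positivity) two_ne_zero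
  linarith

/-- For `a = 2` the bound `x - u + v < π / 2` of `InRegion` reads `v < u`. If it failed, then the
edge `f₂ = 0` would hold with a negative hyperbolic cosine on one side, which the sign of the full
determinant excludes. -/
theorem sub_lt_pi_div_two_of_edge {z u v : ℝ} (hu : 0 < u) (hv : 0 < v)
    (hv' : 2 * v < z) (hz : z ≤ π / 3)
    (h₁ : f₁ (halfAngles (π / 2) z u v) = 0) (h₂ : f₂ (halfAngles (π / 2) z u v) = 0)
    (hT : triangleDet (cos (2 * u)) (cos (2 * (π / 2 - 2 * u))) (cos (2 * v)) < 0)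
    (hdet : 0 < (1 + cos (2 * (z - 2 * v))) * (1 + cos (2 * (π / 2 - 2 * u))) -
      (cos (2 * u) - cos (2 * v)) ^ 2) :
    v < u := by
  by_contra! huv
  have hpi := pi_pos
  have hs : 0 < sin (2 * u) := sin_pos_of_pos_of_lt_pi (by linarith) (by linarith)
  have hX : 0 < cos (2 * u) := cos_pos_of_mem_Ioo ⟨by linarith, by linarith⟩
  have hsv : 0 < sin (2 * v) := sin_pos_of_pos_of_lt_pi (by linarith) (by linarith)
  have hsB : 0 < sin (2 * (z - 2 * v)) := sin_pos_of_pos_of_lt_pi (by linarith) (by linarith)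
  have hcB : 0 < cos (z - 2 * v) := cos_pos_of_mem_Ioo ⟨by linarith, by linarith⟩
  have hY : 1 / 2 < cos (2 * v) := by
    rw [← cos_pi_div_three]
    exact cos_lt_cos_of_nonneg_of_le_pi (by linarith) (by linarith) (by linarith)
  have hXY : cos (2 * v) ≤ cos (2 * u) :=
    cos_le_cos_of_nonneg_of_le_pi (by linarith) (by linarith) (by linarith)
  have hvB : sin (2 * v) ≤ cos (z - 2 * v) := by
    rw [← cos_pi_div_two_sub (2 * v)]
    exact cos_le_cos_of_nonneg_of_le_pi (by linarith) (by linarith) (by linarith)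
  have hW : cos (2 * (π / 2 - 2 * u)) = 1 - 2 * cos (2 * u) ^ 2 := by
    rw [show 2 * (π / 2 - 2 * u) = π - 2 * (2 * u) by ring, cos_pi_sub, cos_two_mul]; ring
  have hsA : sin (2 * (π / 2 - 2 * u)) = 2 * sin (2 * u) * cos (2 * u) := by
    rw [show 2 * (π / 2 - 2 * u) = π - 2 * (2 * u) by ring, sin_pi_sub, sin_two_mul]
  have hV : cos (2 * (z - 2 * v)) = 2 * cos (z - 2 * v) ^ 2 - 1 := cos_two_mul _
  -- The law of sines relation between the four angles.
  have hE : sin (2 * v) = 2 * cos (2 * u) * sin (2 * (z - 2 * v)) := by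
    have e : (sin (2 * v) * sin (2 * u)) ^ 2 =
        (2 * sin (2 * u) * cos (2 * u) * sin (2 * (z - 2 * v))) ^ 2 := by
      rw [← hsA]
      refine mul_left_cancel₀ hT.ne ?_
      have e1 : triangleDet (cos (2 * u)) (cos (2 * (π / 2 - 2 * u))) (cos (2 * v)) *
          sin (2 * v) ^ 2 - triangleDet (cos (2 * u)) (cos (2 * v)) (cos (2 * (z - 2 * v))) *
          sin (2 * (π / 2 - 2 * u)) ^ 2 = 0 := h₁
      have e2 : triangleDet (cos (2 * u)) (cos (2 * v)) (cos (2 * (z - 2 * v))) *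
          sin (2 * u) ^ 2 - triangleDet (cos (2 * u)) (cos (2 * (π / 2 - 2 * u))) (cos (2 * v)) *
          sin (2 * (z - 2 * v)) ^ 2 = 0 := h₂
      linear_combination sin (2 * u) ^ 2 * e1 + sin (2 * (π / 2 - 2 * u)) ^ 2 * e2
    have e' := (pow_left_inj₀ (by positivity) (by positivity) two_ne_zero).1 e
    refine mul_right_cancel₀ hs.ne' ?_
    linarith
  -- The vertex triangle at `A₀` would have a negative hyperbolic cosine.
  have hP : cos (2 * (π / 2 - 2 * u)) + cos (2 * u) * cos (2 * v) < 0 := by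
    have a1 := cos_add_cos_mul_cos_sub (π / 2 - 2 * u) u v
    have c1 : cos (π / 2 - 2 * u + u + v) ≤ 0 :=
      cos_nonpos_of_pi_div_two_le_of_le (by linarith) (by linarith)
    have c2 : 0 < cos (π / 2 - 2 * u - u - v) :=
      cos_pos_of_mem_Ioo ⟨by linarith, by linarith⟩
    rw [triangleDet_comm, triangleDet_eq_sin_sub] at hT
    have := mul_nonpos_of_nonpos_of_nonneg c1 c2.le
    have hσ := mul_pos hs hsv
    by_contra! h
    nlinarith
  rw [hV, hW] at hdet
  rw [hW] at hP
  have hdiff : cos (2 * u) - cos (2 * v) < 2 * sin (2 * u) * cos (z - 2 * v) := by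
    refine lt_of_pow_lt_pow_left₀ 2 (by positivity) ?_
    have := sin_sq_add_cos_sq (2 * u)
    nlinarith
  have hQ : cos (z - 2 * v) ^ 2 ≤ cos (2 * u) + cos (2 * v) * cos (2 * (z - 2 * v)) := by
    rw [hV]
    nlinarith [sq_nonneg (cos (z - 2 * v))]
  rw [f₂_eq] at h₂
  simp only [halfAngles] at h₂
  rw [hW, ← mul_pow, ← mul_pow, sub_eq_zero, ← neg_sq (_ * _)] at h₂
  have hcB2 : 0 < cos (z - 2 * v) ^ 2 := by positivity
  have hle := (pow_left_inj₀
    (neg_nonneg.2 (mul_nonpos_of_nonneg_of_nonpos hsB.le hP.le))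
    (mul_nonneg hs.le (hcB2.le.trans hQ)) two_ne_zero).1 h₂
  set s := sin (2 * u)
  set X := cos (2 * u)
  set Y := cos (2 * v)
  set c := cos (z - 2 * v)
  set r := sin (2 * (z - 2 * v))
  have hX1 : X ≤ 1 := cos_le_one _
  have i1 : -(r * (1 - 2 * X ^ 2 + X * Y)) ≤ r * (X * (X - Y)) := by nlinarith
  have i2 : r * (X * (X - Y)) < r * (X * (2 * s * c)) := by
    gcongr
  have i3 : r * (X * (2 * s * c)) = s * (sin (2 * v) * c) := by rw [hE]; ring
  have i4 : s * (sin (2 * v) * c) ≤ s * c ^ 2 := by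
    rw [sq]; gcongr
  have i5 := mul_le_mul_of_nonneg_left hQ hs.le
  linarith

/-- For `a = 2` and `b = 3` the bound `z + u - v < π / 2` of `InRegion` is not automatic. If it
failed, then the two squares in `f₂_eq` would be too far apart numerically. -/
theorem add_lt_pi_div_two_of_edge {u v : ℝ} (hu' : 2 * u < π / 2) (hv : 0 < v)
    (h₂ : f₂ (halfAngles (π / 2) (π / 3) u v) = 0)
    (hT : triangleDet (cos (2 * u)) (cos (2 * v)) (cos (2 * (π / 3 - 2 * v))) < 0) :
    π / 3 + u - v < π / 2 := by
  by_contra! huv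
  have hpi := pi_pos
  have hs : 0 < sin (2 * u) := sin_pos_of_pos_of_lt_pi (by linarith) (by linarith)
  have hX : 0 < cos (2 * u) := cos_pos_of_mem_Ioo ⟨by linarith, by linarith⟩
  have hsv : 0 < sin (2 * v) := sin_pos_of_pos_of_lt_pi (by linarith) (by linarith)
  have hv3 : π / 6 + 3 * v < u := by
    by_contra! hle
    have b1 := cos_add_cos_mul_cos_sub (π / 3 - 2 * v) u v
    have c1 : cos (π / 3 - 2 * v + u + v) ≤ 0 :=
      cos_nonpos_of_pi_div_two_le_of_le (by linarith) (by linarith)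
    have c2 : 0 < cos (π / 3 - 2 * v - u - v) :=
      cos_pos_of_mem_Ioo ⟨by linarith, by linarith⟩
    have b2 := cos_add_cos_mul_cos_add (π / 3 - 2 * v) u v
    have c3 : 0 ≤ cos (π / 3 - 2 * v + u - v) :=
      cos_nonneg_of_mem_Icc ⟨by linarith, by linarith⟩
    have c4 : 0 < cos (π / 3 - 2 * v - u + v) :=
      cos_pos_of_mem_Ioo ⟨by linarith, by linarith⟩
    have hT' : triangleDet (cos (2 * (π / 3 - 2 * v))) (cos (2 * u)) (cos (2 * v)) < 0 := by
      convert hT using 1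
      unfold triangleDet; ring
    rw [triangleDet_eq_prod_cos] at hT'
    have := mul_nonneg_of_nonpos_of_nonpos
      (mul_nonpos_of_nonpos_of_nonneg c1 c2.le) (neg_nonpos.2 (mul_nonneg c3 c4.le))
    nlinarith
  have hX2 : cos (2 * u) < 1 / 2 := by
    rw [← cos_pi_div_three]
    exact cos_lt_cos_of_nonneg_of_le_pi (by linarith) (by linarith) (by linarith)
  have h3 : (173 : ℝ) / 100 < √3 := by
    rw [lt_sqrt (by norm_num)]; norm_num
  have hY : 86 / 100 < cos (2 * v) := by
    have : cos (π / 6) ≤ cos (2 * v) :=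
      cos_le_cos_of_nonneg_of_le_pi (by linarith) (by linarith) (by linarith)
    rw [cos_pi_div_six] at this
    linarith
  have hY1 : cos (2 * v) ≤ 1 := cos_le_one _
  have hW : cos (2 * (π / 2 - 2 * u)) = 1 - 2 * cos (2 * u) ^ 2 := by
    rw [show 2 * (π / 2 - 2 * u) = π - 2 * (2 * u) by ring, cos_pi_sub, cos_two_mul]; ring
  have hr : 86 / 100 < sin (2 * (π / 3 - 2 * v)) := by
    rw [show 2 * (π / 3 - 2 * v) = π - (π / 3 + 4 * v) by ring, sin_pi_sub]
    have : sin (π / 3) ≤ sin (π / 3 + 4 * v) :=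
      sin_le_sin_of_le_of_le_pi_div_two (by linarith) (by linarith) (by linarith)
    rw [sin_pi_div_three] at this
    linarith
  have hV0 : cos (2 * (π / 3 - 2 * v)) ≤ 0 :=
    cos_nonpos_of_pi_div_two_le_of_le (by linarith) (by linarith)
  have hV1 : -(1 / 2) ≤ cos (2 * (π / 3 - 2 * v)) := by
    rw [← cos_pi_div_three, ← cos_pi_sub]
    exact cos_le_cos_of_nonneg_of_le_pi (by linarith) (by linarith) (by linarith)
  have hs1 := sin_sq_le_one (2 * u)
  rw [f₂_eq] at h₂
  simp only [halfAngles] at h₂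
  rw [hW] at h₂
  set s := sin (2 * u)
  set X := cos (2 * u)
  set Y := cos (2 * v)
  set V := cos (2 * (π / 3 - 2 * v))
  set r := sin (2 * (π / 3 - 2 * v))
  have hP : 93 / 100 ≤ 1 - 2 * X ^ 2 + X * Y := by nlinarith
  have hrP : (86 / 100) * (93 / 100) ≤ r * (1 - 2 * X ^ 2 + X * Y) :=
    mul_le_mul hr.le hP (by norm_num) (by linarith)
  have hQ : (X + Y * V) ^ 2 ≤ (1 / 2) ^ 2 := by
    apply sq_le_sq'
    · nlinarith
    · nlinarith
  have i1 : s ^ 2 * (X + Y * V) ^ 2 ≤ 1 * (1 / 2) ^ 2 :=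
    mul_le_mul hs1 hQ (by positivity) (by norm_num)
  rw [← mul_pow] at h₂
  nlinarith

/-! ### Location of the solutions -/

/-- The reduced edge functions are both of this shape; they express proportionality of tangents. -/
theorem sin_mul_sin_sub_sin_mul_sin (p q u v : ℝ) :
    sin (q - p) * sin (u + v) - sin (p + q) * sin (u - v) =
      2 * (sin q * cos p * (cos u * sin v) - sin p * cos q * (sin u * cos v)) := by
  rw [sin_sub, sin_add, sin_add, sin_sub]; ring

theorem redEdge₁_eq_sin (x z u v : ℝ) :
    redEdge₁ (x + z) (x - z) (u + v) (u - v) =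
      2 * (sin (z - 2 * v + u) * cos (x - 2 * u + v) * (cos u * sin v) -
        sin (x - 2 * u + v) * cos (z - 2 * v + u) * (sin u * cos v)) := by
  rw [← sin_mul_sin_sub_sin_mul_sin, redEdge₁]; ring_nf

theorem redEdge₂_eq_sin (x z u v : ℝ) :
    redEdge₂ (x + z) (x - z) (u + v) (u - v) =
      2 * (sin (u - (z - 2 * v)) * cos (x - 2 * u - v) * (cos u * sin v) -
        sin (x - 2 * u - v) * cos (u - (z - 2 * v)) * (sin u * cos v)) := by
  rw [← sin_mul_sin_sub_sin_mul_sin, redEdge₂]; ring_nf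

theorem tan_mul_tan_eq_of_sin {p q u v : ℝ} (hp : cos p ≠ 0) (hq : cos q ≠ 0) (hu : cos u ≠ 0)
    (hv : cos v ≠ 0)
    (h : 2 * (sin q * cos p * (cos u * sin v) - sin p * cos q * (sin u * cos v)) = 0) :
    tan p * tan u = tan q * tan v := by
  simp only [tan_eq_sin_div_cos]
  field_simp
  linear_combination -h / 2

/-- The quotient `tan (2 t) / tan t` increases. -/
theorem tan_two_mul_lt {s t : ℝ} (hs : 0 < s) (hst : s < t) (ht : 2 * t < π / 2) :
    tan (2 * s) * tan t < tan (2 * t) * tan s := by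
  have hpi := pi_pos
  have c1 : 0 < cos s := cos_pos_of_mem_Ioo ⟨by linarith, by linarith⟩
  have c2 : 0 < cos t := cos_pos_of_mem_Ioo ⟨by linarith, by linarith⟩
  have c3 : 0 < cos (2 * s) := cos_pos_of_mem_Ioo ⟨by linarith, by linarith⟩
  have c4 : 0 < cos (2 * t) := cos_pos_of_mem_Ioo ⟨by linarith, by linarith⟩
  have s1 : 0 < sin s := sin_pos_of_pos_of_lt_pi hs (by linarith)
  have s2 : 0 < sin t := sin_pos_of_pos_of_lt_pi (by linarith) (by linarith)
  have hc : cos t < cos s := cos_lt_cos_of_nonneg_of_le_pi hs.le (by linarith) hst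
  have hc2 : cos t ^ 2 < cos s ^ 2 := by gcongr
  simp only [tan_eq_sin_div_cos]
  rw [div_mul_div_comm, div_mul_div_comm, div_lt_div_iff₀ (by positivity) (by positivity),
    sin_two_mul, sin_two_mul]
  have e : 2 * sin t * cos t * sin s * (cos (2 * s) * cos t) -
      2 * sin s * cos s * sin t * (cos (2 * t) * cos s) =
      2 * sin s * sin t * (cos s ^ 2 - cos t ^ 2) := by
    rw [cos_two_mul, cos_two_mul]; ring
  have : 0 < 2 * sin s * sin t * (cos s ^ 2 - cos t ^ 2) := by
    have := sub_pos.2 hc2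
    positivity
  linarith

/-- The range of the parameters `x = π / a` and `z = π / b`. -/
structure Admissible (x z : ℝ) : Prop where
  z_pos : 0 < z
  z_lt : z < x
  x_le : x ≤ π / 2
  z_le : z ≤ π / 3

/-- The region of `w = (α₁ + β₁) / 2` and `δ = (α₁ - β₁) / 2` that contains all solutions. -/
structure InCore (x z w δ : ℝ) : Prop where
  lt_δ : x - z < 2 * δ
  δ_lt : δ < x - z
  lt_w : x + z < 3 * w
  w_lt : 2 * w < x + z
  δ_lt_w : δ < w

theorem sin_lt_sin_sub {S w : ℝ} (hw : 0 < w) (hw' : 2 * w < S) (hS : S < π) :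
    sin w < sin (S - w) := by
  have h := sin_sub_sin (S - w) w
  rw [show S - w + w = S by ring, show S - w - w = S - 2 * w by ring] at h
  have h1 : 0 < sin ((S - 2 * w) / 2) := sin_pos_of_pos_of_lt_pi (by linarith) (by linarith)
  have h2 : 0 < cos (S / 2) := cos_pos_of_mem_Ioo ⟨by linarith [pi_pos], by linarith⟩
  have := mul_pos h1 h2
  linarith

namespace InRegion

variable {x z u v : ℝ}

theorem tan_eq₁ (h : InRegion x z u v)
    (h₁ : redEdge₁ (x + z) (x - z) (u + v) (u - v) = 0) :
    tan (x - 2 * u + v) * tan u = tan (z - 2 * v + u) * tan v := by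
  have hpi := pi_pos
  obtain ⟨hu, hu', hv, hv', hx, hz, ha, hb⟩ := h
  rw [redEdge₁_eq_sin] at h₁
  refine tan_mul_tan_eq_of_sin ?_ ?_ ?_ ?_ h₁ <;>
  exact (cos_pos_of_mem_Ioo ⟨by linarith, by linarith⟩).ne'

theorem tan_eq₂ (h : InRegion x z u v)
    (h₂ : redEdge₂ (x + z) (x - z) (u + v) (u - v) = 0) :
    tan (x - 2 * u - v) * tan u = tan (u - (z - 2 * v)) * tan v := by
  have hpi := pi_pos
  obtain ⟨hu, hu', hv, hv', hx, hz, ha, hb⟩ := h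
  rw [redEdge₂_eq_sin] at h₂
  refine tan_mul_tan_eq_of_sin ?_ ?_ ?_ ?_ h₂ <;>
  exact (cos_pos_of_mem_Ioo ⟨by linarith, by linarith⟩).ne'

/-- Solutions satisfy `β₁ < α₁`: otherwise one of the two tangent equations compares quantities in
the wrong order, because `tan (2 t) / tan t` increases. -/
theorem lt_of_redEdge (h : InRegion x z u v) (hp : Admissible x z)
    (h₁ : redEdge₁ (x + z) (x - z) (u + v) (u - v) = 0)
    (h₂ : redEdge₂ (x + z) (x - z) (u + v) (u - v) = 0) : v < u := by
  have t₁ := h.tan_eq₁ h₁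
  have t₂ := h.tan_eq₂ h₂
  have hpi := pi_pos
  obtain ⟨hz0, hzx, -, hz3⟩ := hp
  obtain ⟨hu, hu', hv, hv', hx, hz, ha, hb⟩ := h
  have tu : 0 < tan u := tan_pos_of_pos_of_lt_pi_div_two hu (by linarith)
  have tv : 0 < tan v := tan_pos_of_pos_of_lt_pi_div_two hv (by linarith)
  have sw : 0 < sin (u + v) := sin_pos_of_pos_of_lt_pi (by linarith) (by linarith)
  by_contra! huv
  rcases huv.eq_or_lt with rfl | huv
  · have : 0 < sin (x - z) := sin_pos_of_pos_of_lt_pi (by linarith) (by linarith)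
    have h4 := mul_pos this sw
    simp [redEdge₁] at h₁
    rw [show z - x = -(x - z) by ring, sin_neg] at h₁
    rcases h₁ with h₁ | h₁ <;> linarith
  have hw : 3 * (u + v) < x + z := by
    by_contra! hw
    have e1 : 0 ≤ sin (3 * (u + v) - (x + z)) :=
      sin_nonneg_of_nonneg_of_le_pi (by linarith) (by linarith)
    have e2 : 0 < sin (x - z - (u - v)) := sin_pos_of_pos_of_lt_pi (by linarith) (by linarith)
    have e3 : sin (u - v) < 0 := sin_neg_of_neg_of_neg_pi_lt (by linarith) (by linarith)
    have := mul_nonneg e1 sw.le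
    have := mul_neg_of_pos_of_neg e2 e3
    unfold redEdge₂ at h₂
    linarith
  have tuv : tan u < tan v := tan_lt_tan_of_lt_of_lt_pi_div_two (by linarith) (by linarith) huv
  have hB : z - 2 * v < u := by
    by_contra! hB
    have e1 : 0 ≤ tan (z - 2 * v - u) :=
      tan_nonneg_of_nonneg_of_le_pi_div_two (by linarith) (by linarith)
    rw [show u - (z - 2 * v) = -(z - 2 * v - u) by ring, tan_neg,
      show x - 2 * u - v = -(v - (x - 2 * u)) by ring, tan_neg] at t₂
    have e2 : tan (v - (x - 2 * u)) < tan (z - 2 * v - u) :=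
      tan_lt_tan_of_lt_of_lt_pi_div_two (by linarith) (by linarith) (by linarith)
    nlinarith
  have hA : v < x - 2 * u := by
    by_contra! hA
    have e1 : 0 < tan (u - (z - 2 * v)) :=
      tan_pos_of_pos_of_lt_pi_div_two (by linarith) (by linarith)
    have e2 : 0 ≤ tan (v - (x - 2 * u)) :=
      tan_nonneg_of_nonneg_of_le_pi_div_two (by linarith) (by linarith)
    rw [show x - 2 * u - v = -(v - (x - 2 * u)) by ring, tan_neg] at t₂
    nlinarith
  have g1 : tan (2 * v) < tan (x - 2 * u + v) :=
    tan_lt_tan_of_lt_of_lt_pi_div_two (by linarith) (by linarith) (by linarith)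
  have g2 : tan (z - 2 * v + u) < tan (2 * u) :=
    tan_lt_tan_of_lt_of_lt_pi_div_two (by linarith) (by linarith) (by linarith)
  have g3 := tan_two_mul_lt hu huv (by linarith)
  have := mul_lt_mul_of_pos_right g1 tu
  have := mul_lt_mul_of_pos_right g2 tv
  linarith

/-- Outside these bounds the two sides of one of the reduced equations have different signs or
sizes. -/
theorem inCore (h : InRegion x z u v) (hp : Admissible x z)
    (h₁ : redEdge₁ (x + z) (x - z) (u + v) (u - v) = 0)
    (h₂ : redEdge₂ (x + z) (x - z) (u + v) (u - v) = 0) :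
    InCore x z (u + v) (u - v) := by
  have huv := h.lt_of_redEdge hp h₁ h₂
  have t₁ := h.tan_eq₁ h₁
  have t₂ := h.tan_eq₂ h₂
  have hpi := pi_pos
  obtain ⟨hz0, hzx, -, hz3⟩ := hp
  obtain ⟨hu, hu', hv, hv', hx, hz, ha, hb⟩ := h
  have tu : 0 < tan u := tan_pos_of_pos_of_lt_pi_div_two hu (by linarith)
  have tv : 0 < tan v := tan_pos_of_pos_of_lt_pi_div_two hv (by linarith)
  have sw : 0 < sin (u + v) := sin_pos_of_pos_of_lt_pi (by linarith) (by linarith)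
  have sd : 0 < sin (u - v) := sin_pos_of_pos_of_lt_pi (by linarith) (by linarith)
  have hδ : u - v < x - z := by
    by_contra! hδ
    have hw : 3 * (u + v) ≤ x + z := by
      by_contra! hw
      have e1 : 0 < sin (3 * (u + v) - (x + z)) :=
        sin_pos_of_pos_of_lt_pi (by linarith) (by linarith)
      have e2 : sin (x - z - (u - v)) ≤ 0 :=
        sin_nonpos_of_nonpos_of_neg_pi_le (by linarith) (by linarith)
      have := mul_pos e1 sw
      have := mul_nonpos_of_nonpos_of_nonneg e2 sd.le
      unfold redEdge₂ at h₂
      linarith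
    have hB : u ≤ z - 2 * v := by linarith
    have hA : x - 2 * u ≤ v := by
      by_contra! hA
      have e1 : 0 < tan (x - 2 * u - v) :=
        tan_pos_of_pos_of_lt_pi_div_two (by linarith) (by linarith)
      have e2 : 0 ≤ tan (z - 2 * v - u) :=
        tan_nonneg_of_nonneg_of_le_pi_div_two (by linarith) (by linarith)
      rw [show u - (z - 2 * v) = -(z - 2 * v - u) by ring, tan_neg] at t₂
      nlinarith
    have g1 : tan (x - 2 * u + v) ≤ tan (2 * v) :=
      strictMonoOn_tan.monotoneOn ⟨by linarith, by linarith⟩ ⟨by linarith, by linarith⟩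
        (by linarith)
    have g2 : tan (2 * u) ≤ tan (z - 2 * v + u) :=
      strictMonoOn_tan.monotoneOn ⟨by linarith, by linarith⟩ ⟨by linarith, by linarith⟩
        (by linarith)
    have g3 := tan_two_mul_lt hv huv (by linarith)
    have := mul_le_mul_of_nonneg_right g1 tu.le
    have := mul_le_mul_of_nonneg_right g2 tv.le
    linarith
  refine ⟨?_, hδ, ?_, by linarith, by linarith⟩
  · by_contra! hD
    have e1 : sin (3 * (u - v) - (x - z)) ≤ sin (u - v) :=
      sin_le_sin_of_le_of_le_pi_div_two (by linarith) (by linarith) (by linarith)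
    have e2 := sin_lt_sin_sub (S := x + z) (w := u + v) (by linarith) (by linarith)
      (by linarith)
    have := mul_le_mul_of_nonneg_right e1 sw.le
    have := mul_lt_mul_of_pos_right e2 sd
    unfold redEdge₁ at h₁
    linarith
  · by_contra! hw
    have e1 : sin (3 * (u + v) - (x + z)) ≤ 0 :=
      sin_nonpos_of_nonpos_of_neg_pi_le (by linarith) (by linarith)
    have e2 : 0 < sin (x - z - (u - v)) :=
      sin_pos_of_pos_of_lt_pi (by linarith) (by linarith)
    have := mul_nonpos_of_nonpos_of_nonneg e1 sw.le
    have := mul_pos e2 sd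
    unfold redEdge₂ at h₂
    linarith

end InRegion

namespace InCore

variable {x z u v : ℝ}

/-- Otherwise the terms of `redEdge₂_eq_sin` would have opposite signs. -/
theorem v_lt (h : InCore x z (u + v) (u - v)) (hp : Admissible x z)
    (h₂ : redEdge₂ (x + z) (x - z) (u + v) (u - v) = 0) : v < x - 2 * u := by
  have hpi := pi_pos
  obtain ⟨hz0, hzx, hx, hz3⟩ := hp
  obtain ⟨h1, h2, h3, h4, h5⟩ := h
  have sY : 0 < sin (u - (z - 2 * v)) := sin_pos_of_pos_of_lt_pi (by linarith) (by linarith)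
  have cX : 0 < cos (x - 2 * u - v) := cos_pos_of_mem_Ioo ⟨by linarith, by linarith⟩
  have cY : 0 < cos (u - (z - 2 * v)) := cos_pos_of_mem_Ioo ⟨by linarith, by linarith⟩
  have cu : 0 < cos u := cos_pos_of_mem_Ioo ⟨by linarith, by linarith⟩
  have cv : 0 < cos v := cos_pos_of_mem_Ioo ⟨by linarith, by linarith⟩
  have su : 0 < sin u := sin_pos_of_pos_of_lt_pi (by linarith) (by linarith)
  have sv : 0 < sin v := sin_pos_of_pos_of_lt_pi (by linarith) (by linarith)
  rw [redEdge₂_eq_sin] at h₂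
  by_contra! hle
  have sX : sin (x - 2 * u - v) ≤ 0 :=
    sin_nonpos_of_nonpos_of_neg_pi_le (by linarith) (by linarith)
  have i1 : 0 < sin (u - (z - 2 * v)) * cos (x - 2 * u - v) * (cos u * sin v) := by positivity
  have i2 : sin (x - 2 * u - v) * (cos (u - (z - 2 * v)) * (sin u * cos v)) ≤ 0 :=
    mul_nonpos_of_nonpos_of_nonneg sX (by positivity)
  linarith

theorem inRegion (h : InCore x z (u + v) (u - v)) (hp : Admissible x z)
    (h₂ : redEdge₂ (x + z) (x - z) (u + v) (u - v) = 0) : InRegion x z u v := by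
  have hA := h.v_lt hp h₂
  have hpi := pi_pos
  obtain ⟨hz0, hzx, hx, hz3⟩ := hp
  obtain ⟨h1, h2, h3, h4, h5⟩ := h
  constructor <;> linarith

end InCore

/-! ### Transversality of the reduced edge functions -/

/-- The Jacobian of the reduced edge functions at a common zero, up to a positive factor, in terms
of `p = tan u`, `q = tan v` and the quotients `k = tan (A + v) / tan v = tan (B + u) / tan u`,
`m = tan (A - v) / tan v = tan (u - B) / tan u`, where `A = x - 2 u` and `B = z - 2 v`. -/
def jacPoly (p q k m : ℝ) : ℝ :=
  (3 + 3 * k ^ 2 * (p * q) - k - k * (p * q)) * (p + q) *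
      (3 * (1 + m ^ 2 * (p * q)) * (p + q) + m * (p - q) * (1 - p * q)) -
    (p - q) * (1 + k) * (1 - k * (p * q)) *
      ((1 - m ^ 2 * (p * q)) * (p - q) - m * (p + q) * (1 + p * q))

/-- The relations `hq` and `hp` are the addition theorems for `2 v = (A + v) - (A - v)` and
`2 u = (B + u) + (u - B)`. They determine `p²` and `q²` rationally from `k` and `m`, so that
`jacPoly` becomes linear in `p q` after division by `p q`. -/
theorem jacPoly_eq {p q k m : ℝ} (hU : k - m + 2 * k * m ≠ 0) (hV : k + m - 2 * k * m ≠ 0)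
    (hq : (k - m) * (1 - q ^ 2) = 2 * (1 + k * m * q ^ 2))
    (hp : (k + m) * (1 - p ^ 2) = 2 * (1 - k * m * p ^ 2)) :
    jacPoly p q k m =
      2 * (k - 1) * (p * q) * (8 * (p * q) * (k - m ^ 2) +
        (10 * (k ^ 2 - m ^ 2) * (k - 1) * (1 + m ^ 2) + 4 * m ^ 2 * (k - 1) ^ 2 * (1 + k) -
          4 * k * (1 - m ^ 2) * (k - m ^ 2)) / ((k - m + 2 * k * m) * (k + m - 2 * k * m))) := by
  unfold jacPoly
  obtain ⟨U, hUd⟩ : ∃ U, U = k - m + 2 * k * m := ⟨_, rfl⟩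
  obtain ⟨V, hVd⟩ : ∃ V, V = k + m - 2 * k * m := ⟨_, rfl⟩
  rw [← hUd, ← hVd]
  rw [← hUd] at hU
  rw [← hVd] at hV
  have hQ : q ^ 2 = (k - m - 2) / U := by
    rw [eq_div_iff hU, hUd]; linarith
  have hP : p ^ 2 = (k + m - 2) / V := by
    rw [eq_div_iff hV, hVd]; linarith
  generalize hQ' : q ^ 2 = Q at *
  generalize hP' : p ^ 2 = P at *
  -- Expanding in powers of `p q`, with `p²` and `q²` as coefficients, `h0` collects the even and
  -- `h1` the odd powers.
  have h0 : (3 - k) * (3 * (P + Q) + m * (P - Q)) - (1 + k) * (P + Q - m * (P - Q)) +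
      ((3 - k) * (6 * m ^ 2) + (3 * k ^ 2 - k) * (6 + 3 * m ^ 2 * (P + Q) - m * (P - Q)) -
        (1 + k) * (2 * m ^ 2 - k * (-2 - m ^ 2 * (P + Q) - m * (P - Q)))) * (P * Q) =
      16 * (k - 1) * (k - m ^ 2) * (P * Q) := by
    rw [hP, hQ]; field_simp; rw [hVd, hUd]; ring
  have h1 : (3 - k) * (6 + 3 * m ^ 2 * (P + Q) - m * (P - Q)) +
      (3 * k ^ 2 - k) * (3 * (P + Q) + m * (P - Q)) -
      (1 + k) * (-2 - m ^ 2 * (P + Q) - m * (P - Q) - k * (P + Q - m * (P - Q))) +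
      ((3 * k ^ 2 - k) * (6 * m ^ 2) + (1 + k) * k * (2 * m ^ 2)) * (P * Q) =
      2 * (k - 1) * ((10 * (k ^ 2 - m ^ 2) * (k - 1) * (1 + m ^ 2) +
        4 * m ^ 2 * (k - 1) ^ 2 * (1 + k) - 4 * k * (1 - m ^ 2) * (k - m ^ 2)) /
          (U * V)) := by
    rw [hP, hQ]; field_simp; rw [hVd, hUd]; ring
  rw [← hQ', ← hP'] at h0 h1
  linear_combination h0 + (p * q) * h1

/-- The relations force `m + 2 < k`, `k m < 1` and hence `m < 1 / 2`, which makes the right-hand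
side of `jacPoly_eq` positive. -/
theorem jacPoly_pos {p q k m : ℝ} (hp0 : 0 < p) (hq0 : 0 < q) (hm : 0 < m) (hmk : m < k)
    (hp1 : p < 1) (hq : (k - m) * (1 - q ^ 2) = 2 * (1 + k * m * q ^ 2))
    (hp : (k + m) * (1 - p ^ 2) = 2 * (1 - k * m * p ^ 2)) :
    0 < jacPoly p q k m := by
  have hk : 0 < k := hm.trans hmk
  have hkm := mul_pos hk hm
  have hU : 0 < k - m + 2 * k * m := by nlinarith
  have hk2 : m + 2 < k := by
    have : 0 < q ^ 2 * (k - m + 2 * k * m) := by positivity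
    linarith
  have hV : 0 < k + m - 2 * k * m := by
    have h : p ^ 2 * (k + m - 2 * k * m) = k + m - 2 := by linarith
    exact pos_of_mul_pos_right (h ▸ by linarith : 0 < p ^ 2 * (k + m - 2 * k * m)) (sq_nonneg p)
  have hkm1 : k * m < 1 := by
    have h : p ^ 2 * (k + m - 2 * k * m) = k + m - 2 := by linarith
    have : p ^ 2 < 1 := by nlinarith
    nlinarith
  have hm1 : m < 1 / 2 := by nlinarith
  have hm2 : m ^ 2 < 1 / 4 := by nlinarith
  have hkm2 : 0 < k - m ^ 2 := by linarith
  rw [jacPoly_eq hU.ne' hV.ne' hq hp]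
  have hT : 0 < 10 * (k ^ 2 - m ^ 2) * (k - 1) * (1 + m ^ 2) + 4 * m ^ 2 * (k - 1) ^ 2 * (1 + k) -
      4 * k * (1 - m ^ 2) * (k - m ^ 2) := by
    have e1 : k * (k - m ^ 2) ≤ k ^ 2 - m ^ 2 := by nlinarith [sq_nonneg m]
    have e0 : 0 < k * (k - m ^ 2) := mul_pos hk hkm2
    have e2 : k * (k - m ^ 2) * 1 ≤ (k ^ 2 - m ^ 2) * ((k - 1) * (1 + m ^ 2)) :=
      mul_le_mul e1 (by nlinarith [sq_nonneg m]) zero_le_one (e0.le.trans e1)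
    have e3 : k * (k - m ^ 2) * (1 - m ^ 2) ≤ k * (k - m ^ 2) * 1 := by
      gcongr; nlinarith [sq_nonneg m]
    have e4 : 0 ≤ 4 * m ^ 2 * (k - 1) ^ 2 * (1 + k) := by positivity
    nlinarith
  have hk1 : 0 < k - 1 := by linarith
  positivity

/-- The Jacobian determinant of the reduced edge functions with respect to `(δ, w)`. -/
noncomputable def jac (S D w δ : ℝ) : ℝ :=
  (3 * cos (3 * δ - D) * sin w - sin (S - w) * cos δ) *
      (3 * cos (3 * w - S) * sin w + sin (3 * w - S) * cos w) -
    (sin (3 * δ - D) * cos w + cos (S - w) * sin δ) *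
      (cos (D - δ) * sin δ - sin (D - δ) * cos δ)

theorem jac_eq_mul_jacPoly (cX cY cX' cY' cu cv p q k m X Y X' Y' u v : ℝ) (hcX : cos X = cX)
    (hcY : cos Y = cY) (hcX' : cos X' = cX') (hcY' : cos Y' = cY') (hcu : cos u = cu)
    (hcv : cos v = cv) (hsX : sin X = cX * (k * q)) (hsY : sin Y = cY * (k * p))
    (hsX' : sin X' = cX' * (m * q)) (hsY' : sin Y' = cY' * (m * p)) (hsu : sin u = cu * p)
    (hsv : sin v = cv * q) :
    (3 * cos (Y - X) * sin (u + v) - sin (X + Y) * cos (u - v)) *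
      (3 * cos (Y' - X') * sin (u + v) + sin (Y' - X') * cos (u + v)) -
    (sin (Y - X) * cos (u + v) + cos (X + Y) * sin (u - v)) *
      (cos (X' + Y') * sin (u - v) - sin (X' + Y') * cos (u - v)) =
    cX * cY * cX' * cY' * cu ^ 2 * cv ^ 2 *
      jacPoly p q k m := by
  simp only [sin_sub, sin_add, cos_sub, cos_add, hcX, hcY, hcX', hcY', hcu, hcv, hsX, hsY, hsX',
    hsY', hsu, hsv, jacPoly]
  ring

/-- The relation `tan (p - q) = tan (2 t)`, cleared of denominators. -/
theorem sin_cos_of_sub_eq_two_mul {p q t : ℝ} (h : p - q = 2 * t) :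
    (sin p * cos q - cos p * sin q) * (cos t ^ 2 - sin t ^ 2) =
      2 * sin t * cos t * (cos p * cos q + sin p * sin q) := by
  rw [← sin_sub, ← cos_sub, h, sin_two_mul, cos_two_mul']

theorem sin_eq_cos_mul_tan {t : ℝ} (h : cos t ≠ 0) : sin t = cos t * tan t := by
  rw [mul_comm, tan_mul_cos h]

/-- The reduced edge functions intersect transversally, with a fixed orientation, at each common
zero. -/
theorem InCore.jac_pos {x z u v : ℝ} (h : InCore x z (u + v) (u - v)) (hp : Admissible x z)
    (h₁ : redEdge₁ (x + z) (x - z) (u + v) (u - v) = 0)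
    (h₂ : redEdge₂ (x + z) (x - z) (u + v) (u - v) = 0) :
    0 < jac (x + z) (x - z) (u + v) (u - v) := by
  have hA := h.v_lt hp h₂
  have hr := h.inRegion hp h₂
  have t₁ := hr.tan_eq₁ h₁
  have t₂ := hr.tan_eq₂ h₂
  have hpi := pi_pos
  obtain ⟨hz0, hzx, hx, hz3⟩ := hp
  obtain ⟨h1, h2, h3, h4, h5⟩ := h
  obtain ⟨hu, hu', hv, hv', -, hz, ha, hb⟩ := hr
  have cu : 0 < cos u := cos_pos_of_mem_Ioo ⟨by linarith, by linarith⟩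
  have cv : 0 < cos v := cos_pos_of_mem_Ioo ⟨by linarith, by linarith⟩
  have cX : 0 < cos (x - 2 * u + v) := cos_pos_of_mem_Ioo ⟨by linarith, by linarith⟩
  have cY : 0 < cos (z - 2 * v + u) := cos_pos_of_mem_Ioo ⟨by linarith, by linarith⟩
  have cX' : 0 < cos (x - 2 * u - v) := cos_pos_of_mem_Ioo ⟨by linarith, by linarith⟩
  have cY' : 0 < cos (u - (z - 2 * v)) := cos_pos_of_mem_Ioo ⟨by linarith, by linarith⟩
  have tu : 0 < tan u := tan_pos_of_pos_of_lt_pi_div_two hu (by linarith)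
  have tv : 0 < tan v := tan_pos_of_pos_of_lt_pi_div_two hv (by linarith)
  have tX' : 0 < tan (x - 2 * u - v) :=
    tan_pos_of_pos_of_lt_pi_div_two (by linarith) (by linarith)
  have tXX' : tan (x - 2 * u - v) < tan (x - 2 * u + v) :=
    tan_lt_tan_of_lt_of_lt_pi_div_two (by linarith) (by linarith) (by linarith)
  have tu1 : tan u < 1 := by
    rw [← tan_pi_div_four]
    exact tan_lt_tan_of_lt_of_lt_pi_div_two (by linarith) (by linarith) (by linarith)
  obtain ⟨k, hk⟩ : ∃ k, k = tan (x - 2 * u + v) / tan v := ⟨_, rfl⟩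
  obtain ⟨m, hm⟩ : ∃ m, m = tan (x - 2 * u - v) / tan v := ⟨_, rfl⟩
  have hm0 : 0 < m := hm ▸ div_pos tX' tv
  have hmk : m < k := by
    rw [hm, hk]; gcongr
  have eX : tan (x - 2 * u + v) = k * tan v := by rw [hk]; field_simp
  have eX' : tan (x - 2 * u - v) = m * tan v := by rw [hm]; field_simp
  have eY : tan (z - 2 * v + u) = k * tan u := by
    rw [eX] at t₁
    exact mul_right_cancel₀ tv.ne' (by linarith)
  have eY' : tan (u - (z - 2 * v)) = m * tan u := by
    rw [eX'] at t₂
    exact mul_right_cancel₀ tv.ne' (by linarith)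
  have su : sin u = cos u * tan u := sin_eq_cos_mul_tan cu.ne'
  have sv : sin v = cos v * tan v := sin_eq_cos_mul_tan cv.ne'
  have sX : sin (x - 2 * u + v) = cos (x - 2 * u + v) * (k * tan v) := by
    rw [← eX, sin_eq_cos_mul_tan cX.ne']
  have sY : sin (z - 2 * v + u) = cos (z - 2 * v + u) * (k * tan u) := by
    rw [← eY, sin_eq_cos_mul_tan cY.ne']
  have sX' : sin (x - 2 * u - v) = cos (x - 2 * u - v) * (m * tan v) := by
    rw [← eX', sin_eq_cos_mul_tan cX'.ne']
  have sY' : sin (u - (z - 2 * v)) = cos (u - (z - 2 * v)) * (m * tan u) := by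
    rw [← eY', sin_eq_cos_mul_tan cY'.ne']
  have hq : (k - m) * (1 - tan v ^ 2) = 2 * (1 + k * m * tan v ^ 2) := by
    have e := sin_cos_of_sub_eq_two_mul
      (show x - 2 * u + v - (x - 2 * u - v) = 2 * v by ring)
    rw [sX, sX', sv] at e
    refine mul_left_cancel₀
      (by positivity : cos (x - 2 * u + v) * cos (x - 2 * u - v) * cos v ^ 2 * tan v ≠ 0) ?_
    linear_combination e
  have hp : (k + m) * (1 - tan u ^ 2) = 2 * (1 - k * m * tan u ^ 2) := by
    have e := sin_cos_of_sub_eq_two_mul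
      (show z - 2 * v + u - -(u - (z - 2 * v)) = 2 * u by ring)
    rw [sin_neg, cos_neg, sY, sY', su] at e
    refine mul_left_cancel₀
      (by positivity : cos (z - 2 * v + u) * cos (u - (z - 2 * v)) * cos u ^ 2 * tan u ≠ 0) ?_
    linear_combination e
  have e := jac_eq_mul_jacPoly _ _ _ _ _ _ _ _ _ _ _ _ _ _ _ _
    rfl rfl rfl rfl rfl rfl sX sY sX' sY' su sv
  have hjac : jac (x + z) (x - z) (u + v) (u - v) = _ := Eq.trans (by unfold jac; ring_nf) e
  rw [hjac]
  have := jacPoly_pos tu tv hm0 hmk tu1 hq hp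
  positivity

open Set Filter Topology

/-! ### Functions decreasing through their zeros -/

theorem eventually_slope_neg {g : ℝ → ℝ} {g' t : ℝ} (h : HasDerivAt g g' t) (h0 : g t = 0)
    (hg' : g' < 0) : ∀ᶠ y in 𝓝[≠] t, (y - t)⁻¹ * g y < 0 := by
  have := (hasDerivAt_iff_tendsto_slope.1 h).eventually (Iio_mem_nhds hg')
  simpa [slope_def_field, h0, div_eq_inv_mul] using this

theorem eventually_neg_right {g : ℝ → ℝ} {g' t : ℝ} (h : HasDerivAt g g' t) (h0 : g t = 0)
    (hg' : g' < 0) : ∀ᶠ y in 𝓝[>] t, g y < 0 := by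
  filter_upwards [(eventually_slope_neg h h0 hg').filter_mono (nhdsGT_le_nhdsNE t),
    self_mem_nhdsWithin] with y hy hty
  exact neg_of_mul_neg_right hy (inv_nonneg.2 (sub_nonneg.2 (le_of_lt hty)))

theorem eventually_pos_left {g : ℝ → ℝ} {g' t : ℝ} (h : HasDerivAt g g' t) (h0 : g t = 0)
    (hg' : g' < 0) : ∀ᶠ y in 𝓝[<] t, 0 < g y := by
  filter_upwards [(eventually_slope_neg h h0 hg').filter_mono (nhdsLT_le_nhdsNE t),
    self_mem_nhdsWithin] with y hy hty
  exact pos_of_mul_neg_right hy (inv_nonpos.2 (sub_nonpos.2 (le_of_lt hty)))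

/-- A continuous function whose derivative is negative at each of its zeros stays negative once it
is nonpositive. -/
theorem neg_of_nonpos_of_deriv_neg {g : ℝ → ℝ} {a b p q : ℝ} (hg : Continuous g)
    (hd : ∀ t ∈ Ioo a b, g t = 0 → ∃ g' < 0, HasDerivAt g g' t)
    (hap : a < p) (hpq : p < q) (hqb : q < b) (hp : g p ≤ 0) : g q < 0 := by
  by_contra! hq
  obtain ⟨r, hpr, hrq, hr⟩ : ∃ r, p ≤ r ∧ r < q ∧ g r < 0 := by
    rcases hp.lt_or_eq with hp | hp
    · exact ⟨p, le_rfl, hpq, hp⟩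
    · obtain ⟨g', hg', h⟩ := hd p ⟨hap, by linarith⟩ hp
      obtain ⟨r, h1, h2⟩ := ((eventually_neg_right h hp hg').and (Ioo_mem_nhdsGT hpq)).exists
      exact ⟨r, h2.1.le, h2.2, h1⟩
  -- The first point `t` after `r` where `g` is nonnegative is a zero with `g < 0` on its left.
  let K : Set ℝ := Icc r q ∩ g ⁻¹' Ici 0
  have hK : IsCompact K := isCompact_Icc.inter_right (isClosed_Ici.preimage hg)
  obtain ⟨t, ⟨⟨hrt, htq⟩, ht0⟩, hmin⟩ := hK.exists_isLeast ⟨q, ⟨hrq.le, le_rfl⟩, hq⟩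
  have ht0 : 0 ≤ g t := ht0
  have hneg : ∀ y, r ≤ y → y < t → g y < 0 := by
    intro y h1 h2
    by_contra! h3
    exact absurd (hmin ⟨⟨h1, by linarith⟩, h3⟩) (not_le.2 h2)
  have hrt' : r < t := lt_of_le_of_ne hrt (by rintro rfl; linarith)
  have hev : ∀ᶠ y in 𝓝[<] t, g y < 0 := by
    filter_upwards [Ioo_mem_nhdsLT hrt'] with y hy using hneg y hy.1.le hy.2
  have ht : g t = 0 := le_antisymm
    (le_of_tendsto (hg.continuousAt.tendsto.mono_left nhdsWithin_le_nhds)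
      (hev.mono fun y hy => hy.le)) ht0
  obtain ⟨g', hg', h⟩ := hd t ⟨by linarith, by linarith⟩ ht
  obtain ⟨y, h1, h2⟩ := (hev.and (eventually_pos_left h ht hg')).exists
  linarith

/-! ### The curve on which the second reduced edge function vanishes -/

/-- On the curve `redEdge₂ = 0`, this is `cos (2 δ - (x - z))` as a function of `w`. -/
noncomputable def curveCos (x z w : ℝ) : ℝ :=
  cos (x - z) + 2 * (sin (3 * w - (x + z)) * sin w)

/-- The branch `δ > (x - z) / 2` of the curve `redEdge₂ = 0` as a graph over `w`. -/
noncomputable def curveδ (x z w : ℝ) : ℝ :=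
  (x - z + arccos (curveCos x z w)) / 2

/-- The first reduced edge function along the curve `redEdge₂ = 0`. -/
noncomputable def curveEdge (x z w : ℝ) : ℝ :=
  redEdge₁ (x + z) (x - z) w (curveδ x z w)

/-- Left end of the range of `w`: `δ < x - z` holds on the curve to the right of `w = (x + z) / 3`,
and `δ < w` to the right of `w = x / 2`. -/
noncomputable def leftEnd (x z : ℝ) : ℝ := max ((x + z) / 3) (x / 2)

/-- The range of `w` over which the curve lies in `InCore`. -/
structure InCurve (x z w : ℝ) : Prop where
  left_lt : leftEnd x z < w
  lt_half : 2 * w < x + z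
  cos_lt : curveCos x z w < 1

theorem two_mul_redEdge₂ (x z w δ : ℝ) :
    2 * redEdge₂ (x + z) (x - z) w δ = curveCos x z w - cos (2 * δ - (x - z)) := by
  have h := two_mul_sin_mul_sin (x - z - δ) δ
  rw [show x - z - δ - δ = -(2 * δ - (x - z)) by ring, cos_neg,
    show x - z - δ + δ = x - z by ring] at h
  unfold redEdge₂ curveCos
  linarith

theorem curveCos_eq (x z w : ℝ) :
    curveCos x z w = cos (x - z) + cos (x + z - 2 * w) - cos (4 * w - (x + z)) := by
  have h := two_mul_sin_mul_sin (3 * w - (x + z)) w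
  rw [show 3 * w - (x + z) - w = -(x + z - 2 * w) by ring, cos_neg,
    show 3 * w - (x + z) + w = 4 * w - (x + z) by ring] at h
  unfold curveCos
  linarith

theorem curveCos_third (x z : ℝ) : curveCos x z ((x + z) / 3) = cos (x - z) := by
  unfold curveCos
  rw [show 3 * ((x + z) / 3) - (x + z) = 0 by ring, sin_zero]; ring

theorem curveCos_half (x z : ℝ) : curveCos x z (x / 2) = cos z := by
  rw [curveCos_eq, show x + z - 2 * (x / 2) = z by ring,
    show 4 * (x / 2) - (x + z) = x - z by ring]; ring

theorem continuous_curveEdge_right (x w : ℝ) : Continuous fun z => curveEdge x z w := by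
  unfold curveEdge redEdge₁ curveδ curveCos
  fun_prop

theorem continuous_curveEdge (x z : ℝ) : Continuous (curveEdge x z) := by
  unfold curveEdge redEdge₁ curveδ curveCos
  fun_prop

namespace Admissible

variable {x z : ℝ}

theorem curveCos_lt (hp : Admissible x z) {w₁ w₂ : ℝ} (h₁ : x + z ≤ 3 * w₁) (h₁₂ : w₁ < w₂)
    (h₂ : 2 * w₂ ≤ x + z) : curveCos x z w₁ < curveCos x z w₂ := by
  have hpi := pi_pos
  obtain ⟨hz0, hzx, hx, hz3⟩ := hp
  rw [curveCos_eq, curveCos_eq]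
  have e1 : cos (x + z - 2 * w₁) < cos (x + z - 2 * w₂) :=
    cos_lt_cos_of_nonneg_of_le_pi (by linarith) (by linarith) (by linarith)
  have e2 : cos (4 * w₂ - (x + z)) < cos (4 * w₁ - (x + z)) :=
    cos_lt_cos_of_nonneg_of_le_pi (by linarith) (by linarith) (by linarith)
  linarith

theorem one_lt_curveCos (hp : Admissible x z) : 1 < curveCos x z ((x + z) / 2) := by
  have hpi := pi_pos
  obtain ⟨hz0, hzx, hx, hz3⟩ := hp
  rw [curveCos_eq, show x + z - 2 * ((x + z) / 2) = 0 by ring,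
    show 4 * ((x + z) / 2) - (x + z) = x + z by ring, cos_zero]
  have : cos (x + z) < cos (x - z) :=
    cos_lt_cos_of_nonneg_of_le_pi (by linarith) (by linarith) (by linarith)
  linarith

theorem cos_lt_curveCos (hp : Admissible x z) {w : ℝ} (hw : x + z < 3 * w)
    (hw' : 2 * w ≤ x + z) : cos (x - z) < curveCos x z w := by
  rw [← curveCos_third]
  exact hp.curveCos_lt (by linarith) (by linarith) hw'

theorem leftEnd_lt_half (hp : Admissible x z) : leftEnd x z < (x + z) / 2 :=
  max_lt (by linarith [hp.z_pos, hp.z_lt]) (by linarith [hp.z_pos])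

theorem curveCos_leftEnd_lt_one (hp : Admissible x z) : curveCos x z (leftEnd x z) < 1 := by
  have hpi := pi_pos
  obtain ⟨hz0, hzx, hx, hz3⟩ := hp
  rcases max_choice ((x + z) / 3) (x / 2) with h | h <;> rw [leftEnd, h]
  · rw [curveCos_third, ← cos_zero]
    exact cos_lt_cos_of_nonneg_of_le_pi le_rfl (by linarith) (by linarith)
  · rw [curveCos_half, ← cos_zero]
    exact cos_lt_cos_of_nonneg_of_le_pi le_rfl (by linarith) (by linarith)

/-- Right end of the range of `w`: there `cos (2 δ - (x - z))` reaches `1`. -/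
theorem exists_rightEnd (hp : Admissible x z) :
    ∃ r, leftEnd x z < r ∧ 2 * r < x + z ∧ curveCos x z r = 1 ∧
      ∀ w, InCurve x z w ↔ leftEnd x z < w ∧ w < r := by
  have hc : Continuous (curveCos x z) := by unfold curveCos; fun_prop
  obtain ⟨r, ⟨h1, h2⟩, h3⟩ := intermediate_value_Ioo hp.leftEnd_lt_half.le hc.continuousOn
    ⟨hp.curveCos_leftEnd_lt_one, hp.one_lt_curveCos⟩
  have h0 : (x + z) / 3 ≤ leftEnd x z := le_max_left _ _
  refine ⟨r, h1, by linarith, h3, fun w => ⟨fun h => ⟨h.left_lt, ?_⟩, fun h => ⟨h.1, ?_, ?_⟩⟩⟩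
  · by_contra! hle
    have h4 := h.cos_lt
    rcases hle.eq_or_lt with rfl | hlt
    · linarith
    · have := hp.curveCos_lt (w₁ := r) (w₂ := w) (by linarith) hlt h.lt_half.le
      linarith
  · linarith [h.2]
  · rw [← h3]
    exact hp.curveCos_lt (by linarith [h.1]) h.2 (by linarith)

end Admissible

namespace InCurve

variable {x z w : ℝ}

theorem lt_three_mul (h : InCurve x z w) : x + z < 3 * w := by
  have := (le_max_left ((x + z) / 3) (x / 2)).trans_lt h.left_lt
  linarith

theorem half_lt (h : InCurve x z w) : x < 2 * w := by
  have := (le_max_right ((x + z) / 3) (x / 2)).trans_lt h.left_lt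
  linarith

end InCurve

theorem cos_two_mul_curveδ {x z w : ℝ} (h1 : -1 ≤ curveCos x z w) (h2 : curveCos x z w ≤ 1) :
    cos (2 * curveδ x z w - (x - z)) = curveCos x z w := by
  rw [show 2 * curveδ x z w - (x - z) = arccos (curveCos x z w) by unfold curveδ; ring,
    cos_arccos h1 h2]

theorem InCurve.redEdge₂_eq_zero {x z w : ℝ} (h : InCurve x z w) (hp : Admissible x z) :
    redEdge₂ (x + z) (x - z) w (curveδ x z w) = 0 := by
  have h1 := hp.cos_lt_curveCos h.lt_three_mul h.lt_half.le
  have h2 := two_mul_redEdge₂ x z w (curveδ x z w)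
  rw [cos_two_mul_curveδ (by linarith [neg_one_le_cos (x - z)]) h.cos_lt.le] at h2
  linarith

theorem InCurve.inCore {x z w : ℝ} (h : InCurve x z w) (hp : Admissible x z) :
    InCore x z w (curveδ x z w) := by
  have hpi := pi_pos
  have h1 := hp.cos_lt_curveCos h.lt_three_mul h.lt_half.le
  have h2 := h.half_lt
  have h3 := h.lt_three_mul
  have h4 := h.lt_half
  have e0 : 0 < arccos (curveCos x z w) := arccos_pos.2 h.cos_lt
  have e1 : arccos (curveCos x z w) < x - z := by
    rw [← arccos_cos (x := x - z) (by linarith [hp.z_lt]) (by linarith [hp.x_le, hp.z_pos])]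
    exact strictAntiOn_arccos ⟨neg_one_le_cos _, cos_le_one _⟩
      ⟨by linarith [neg_one_le_cos (x - z)], h.cos_lt.le⟩ h1
  refine ⟨by unfold curveδ; linarith, by unfold curveδ; linarith, h3, h4, ?_⟩
  rcases le_or_gt (2 * z) x with hz | hz
  · -- On the curve, `δ = w` at `w = x / 2`, and `δ` decreases with `w`.
    have e2 : arccos (curveCos x z w) < z := by
      refine lt_of_lt_of_eq ?_ (arccos_cos (x := z) hp.z_pos.le (by linarith [hp.z_le]))
      refine strictAntiOn_arccos ⟨neg_one_le_cos _, cos_le_one _⟩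
        ⟨by linarith [neg_one_le_cos (x - z)], h.cos_lt.le⟩ ?_
      rw [← curveCos_half x z]
      exact hp.curveCos_lt (by linarith) (by linarith) h4.le
    unfold curveδ; linarith
  · unfold curveδ; linarith

/-- The solutions are the zeros of the first reduced edge function along the curve. -/
theorem inCore_iff {x z w δ : ℝ} (hp : Admissible x z) :
    InCore x z w δ ∧ redEdge₁ (x + z) (x - z) w δ = 0 ∧ redEdge₂ (x + z) (x - z) w δ = 0 ↔
      InCurve x z w ∧ curveEdge x z w = 0 ∧ δ = curveδ x z w := by
  have hpi := pi_pos
  constructor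
  · rintro ⟨h, h₁, h₂⟩
    obtain ⟨a1, a2, a3, a4, a5⟩ := h
    have h3 := two_mul_redEdge₂ x z w δ
    rw [h₂, mul_zero, eq_comm, sub_eq_zero] at h3
    have hδ : δ = curveδ x z w := by
      unfold curveδ
      rw [h3, arccos_cos (by linarith) (by linarith [hp.x_le, hp.z_pos])]
      ring
    refine ⟨⟨max_lt (by linarith) ?_, a4, ?_⟩, by rw [curveEdge, ← hδ, h₁], hδ⟩
    · by_contra! hle
      have e1 : curveCos x z w ≤ cos z := by
        rw [← curveCos_half x z]
        rcases hle.eq_or_lt with rfl | hlt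
        · exact le_rfl
        · exact (hp.curveCos_lt a3.le hlt (by linarith [hp.z_pos])).le
      have e2 : z ≤ 2 * δ - (x - z) := by
        by_contra! hlt
        have := cos_lt_cos_of_nonneg_of_le_pi (x := 2 * δ - (x - z)) (y := z) (by linarith)
          (by linarith [hp.z_le]) hlt
        linarith
      linarith
    · rw [h3, ← cos_zero]
      exact cos_lt_cos_of_nonneg_of_le_pi le_rfl (by linarith [hp.x_le, hp.z_pos]) (by linarith)
  · rintro ⟨h, h₁, rfl⟩
    exact ⟨h.inCore hp, h₁, h.redEdge₂_eq_zero hp⟩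

/-- By implicit differentiation, the derivative along the curve is a Jacobian determinant. -/
theorem hasDerivAt_curveEdge {x z w : ℝ} (h1 : -1 < curveCos x z w) (h2 : curveCos x z w < 1) :
    HasDerivAt (curveEdge x z)
      (-jac (x + z) (x - z) w (curveδ x z w) / sin (2 * curveδ x z w - (x - z))) w := by
  have hs : sin (2 * curveδ x z w - (x - z)) = √(1 - curveCos x z w ^ 2) := by
    rw [show 2 * curveδ x z w - (x - z) = arccos (curveCos x z w) by unfold curveδ; ring,
      sin_arccos]
  have hs0 : 0 < √(1 - curveCos x z w ^ 2) := sqrt_pos.2 (by nlinarith)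
  have d1 : HasDerivAt (fun w => sin (3 * w - (x + z)))
      (cos (3 * w - (x + z)) * 3) w := by
    simpa using (((hasDerivAt_id w).const_mul 3).sub_const (x + z)).sin
  have d2 : HasDerivAt (curveCos x z)
      (2 * (cos (3 * w - (x + z)) * 3 * sin w + sin (3 * w - (x + z)) * cos w)) w :=
    ((d1.mul (hasDerivAt_sin w)).const_mul 2).const_add _
  have d3 := (hasDerivAt_arccos h1.ne' h2.ne).comp w d2
  have d4 : HasDerivAt (curveδ x z) (-(3 * cos (3 * w - (x + z)) * sin w +
      sin (3 * w - (x + z)) * cos w) / √(1 - curveCos x z w ^ 2)) w := by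
    refine HasDerivAt.congr_deriv ((d3.const_add (x - z)).div_const 2) ?_
    ring
  set δ' := -(3 * cos (3 * w - (x + z)) * sin w +
      sin (3 * w - (x + z)) * cos w) / √(1 - curveCos x z w ^ 2) with hδ'
  have d5 : HasDerivAt (fun w => sin (3 * curveδ x z w - (x - z)))
      (cos (3 * curveδ x z w - (x - z)) * (3 * δ')) w :=
    ((d4.const_mul 3).sub_const (x - z)).sin
  have d6 : HasDerivAt (fun w => sin (x + z - w)) (cos (x + z - w) * (-1)) w :=
    ((hasDerivAt_id w).const_sub (x + z)).sin
  have d7 := (d5.mul (hasDerivAt_sin w)).sub (d6.mul d4.sin)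
  refine d7.congr_deriv ?_
  have hs' : cos (x - z - curveδ x z w) * sin (curveδ x z w) -
      sin (x - z - curveδ x z w) * cos (curveδ x z w) = √(1 - curveCos x z w ^ 2) := by
    rw [← hs, show 2 * curveδ x z w - (x - z) = curveδ x z w - (x - z - curveδ x z w) by ring,
      sin_sub (curveδ x z w)]
    ring
  rw [hs, jac, hs', hδ']
  field_simp
  ring

theorem InCurve.hasDerivAt_neg {x z w : ℝ} (h : InCurve x z w) (hp : Admissible x z)
    (h0 : curveEdge x z w = 0) : ∃ g' < 0, HasDerivAt (curveEdge x z) g' w := by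
  have hpi := pi_pos
  have hc := h.inCore hp
  have h1 := hp.cos_lt_curveCos h.lt_three_mul h.lt_half.le
  refine ⟨_, ?_, hasDerivAt_curveEdge (by linarith [neg_one_le_cos (x - z)]) h.cos_lt⟩
  refine div_neg_of_neg_of_pos (neg_neg_of_pos ?_)
    (sin_pos_of_pos_of_lt_pi (by linarith [hc.lt_δ])
      (by linarith [hc.δ_lt, hp.z_pos, hp.x_le]))
  have e1 : w = (w + curveδ x z w) / 2 + (w - curveδ x z w) / 2 := by ring
  have e2 : curveδ x z w = (w + curveδ x z w) / 2 - (w - curveδ x z w) / 2 := by ring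
  have key : InCore x z ((w + curveδ x z w) / 2 + (w - curveδ x z w) / 2)
      ((w + curveδ x z w) / 2 - (w - curveδ x z w) / 2) := by rwa [← e1, ← e2]
  have := key.jac_pos hp (by rw [← e1, ← e2]; exact h0)
    (by rw [← e1, ← e2]; exact h.redEdge₂_eq_zero hp)
  rwa [← e1, ← e2] at this

/-! ### The behaviour at the left end of the curve -/

/-- The difference of the two sides of the main inequality, for real parameters. -/
noncomputable def mainGap (x z : ℝ) : ℝ :=
  (1 + cos x) * sin (2 * z) - (cos x + cos (2 * z)) * sin x

theorem mainGap_eq (x z : ℝ) :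
    mainGap x z = 2 * cos (x / 2) * (sin (2 * z - x / 2) - cos x * sin (x / 2)) := by
  have h1 : cos x = 2 * cos (x / 2) ^ 2 - 1 := by
    rw [← cos_two_mul, show 2 * (x / 2) = x by ring]
  have h2 : sin x = 2 * sin (x / 2) * cos (x / 2) := by
    rw [← sin_two_mul, show 2 * (x / 2) = x by ring]
  rw [mainGap, sin_sub, h1, h2]; ring

namespace Admissible

variable {x z : ℝ}

theorem cos_half_pos (hp : Admissible x z) : 0 < cos (x / 2) :=
  cos_pos_of_mem_Ioo ⟨by linarith [hp.z_pos, hp.z_lt, pi_pos], by linarith [hp.x_le, pi_pos]⟩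

theorem mainGap_pos_of_le (hp : Admissible x z) (h : x ≤ 2 * z) : 0 < mainGap x z := by
  have hpi := pi_pos
  have hc := hp.cos_half_pos
  obtain ⟨hz0, hzx, hx, hz3⟩ := hp
  have hs : 0 < sin (x / 2) := sin_pos_of_pos_of_lt_pi (by linarith) (by linarith)
  have hc1 : cos x < 1 := by
    rw [← cos_zero]
    exact cos_lt_cos_of_nonneg_of_le_pi le_rfl (by linarith) (by linarith)
  have h1 : sin (x / 2) ≤ sin (2 * z - x / 2) := by
    have e := sin_sub_sin (2 * z - x / 2) (x / 2)
    rw [show 2 * z - x / 2 - x / 2 = 2 * z - x by ring,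
      show (2 * z - x / 2 + x / 2) / 2 = z by ring] at e
    have e1 : 0 ≤ sin ((2 * z - x) / 2) :=
      sin_nonneg_of_nonneg_of_le_pi (by linarith) (by linarith)
    have e2 : 0 ≤ cos z := cos_nonneg_of_mem_Icc ⟨by linarith, by linarith⟩
    have := mul_nonneg e1 e2
    linarith
  rw [mainGap_eq]
  have : cos x * sin (x / 2) < sin (x / 2) := by nlinarith
  have : 0 < sin (2 * z - x / 2) - cos x * sin (x / 2) := by linarith
  positivity

theorem mainGap_lt (hp : Admissible x z) {z' : ℝ} (h0 : 0 < z') (h : z' < z) (hz : 2 * z ≤ x) :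
    mainGap x z' < mainGap x z := by
  have hc := hp.cos_half_pos
  rw [mainGap_eq, mainGap_eq]
  have : sin (2 * z' - x / 2) < sin (2 * z - x / 2) :=
    sin_lt_sin_of_lt_of_le_pi_div_two (by linarith [hp.x_le, pi_pos])
      (by linarith [hp.x_le, pi_pos]) (by linarith)
  have : sin (2 * z' - x / 2) - cos x * sin (x / 2) <
    sin (2 * z - x / 2) - cos x * sin (x / 2) := by linarith
  gcongr

theorem curveδ_half (hp : Admissible x z) : curveδ x z (x / 2) = x / 2 := by
  rw [curveδ, curveCos_half, arccos_cos hp.z_pos.le (by linarith [hp.z_le, pi_pos])]; ring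

/-- At `w = x / 2` the curve passes through the degenerate solution `α₁ = x`, `β₁ = 0`. -/
theorem curveEdge_half (hp : Admissible x z) : curveEdge x z (x / 2) = 0 := by
  rw [curveEdge, hp.curveδ_half, redEdge₁, show 3 * (x / 2) - (x - z) = x + z - x / 2 by ring,
    sub_self]

theorem jac_half (x z : ℝ) : jac (x + z) (x - z) (x / 2) (x / 2) =
    -2 * ((1 - cos (2 * z)) * (1 - cos x) + sin x * sin (2 * z) - sin x ^ 2) := by
  have e1 : ∀ t, 2 * (cos (x / 2 + t) * sin (x / 2)) = sin (x + t) - sin t := by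
    intro t
    have := two_mul_sin_mul_cos (x / 2) (x / 2 + t)
    rw [show x / 2 - (x / 2 + t) = -t by ring, sin_neg,
      show x / 2 + (x / 2 + t) = x + t by ring] at this
    linarith
  have e2 : ∀ t, 2 * (sin (x / 2 + t) * cos (x / 2)) = sin (x + t) + sin t := by
    intro t
    have := two_mul_sin_mul_cos (x / 2 + t) (x / 2)
    rw [show x / 2 + t - x / 2 = t by ring, show x / 2 + t + x / 2 = x + t by ring] at this
    linarith
  have g1 : 3 * cos (x / 2 + z) * sin (x / 2) - sin (x / 2 + z) * cos (x / 2) =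
      sin (x + z) - 2 * sin z := by linear_combination 3 / 2 * e1 z - 1 / 2 * e2 z
  have g2 : 3 * cos (x / 2 - z) * sin (x / 2) + sin (x / 2 - z) * cos (x / 2) =
      2 * sin (x - z) + sin z := by
    have a1 := e1 (-z)
    have a2 := e2 (-z)
    rw [sin_neg, ← sub_eq_add_neg, ← sub_eq_add_neg] at a1 a2
    linear_combination 3 / 2 * a1 + 1 / 2 * a2
  have g3 : sin (x / 2 + z) * cos (x / 2) + cos (x / 2 + z) * sin (x / 2) = sin (x + z) := by
    linear_combination 1 / 2 * e1 z + 1 / 2 * e2 z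
  have g4 : cos (x / 2 - z) * sin (x / 2) - sin (x / 2 - z) * cos (x / 2) = sin z := by
    rw [mul_comm (cos _), mul_comm (sin (x / 2 - z)), ← sin_sub]; ring_nf
  rw [jac, show 3 * (x / 2) - (x - z) = x / 2 + z by ring, show x + z - x / 2 = x / 2 + z by ring,
    show 3 * (x / 2) - (x + z) = x / 2 - z by ring, show x - z - x / 2 = x / 2 - z by ring,
    g1, g2, g3, g4, sin_add, sin_sub, sin_two_mul, cos_two_mul]
  linear_combination 2 * sin x ^ 2 * sin_sq_add_cos_sq z - 2 * sin z ^ 2 * sin_sq_add_cos_sq x -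
    4 * (1 - cos x) * sin_sq_add_cos_sq z

/-- At the left end `w = x / 2` the derivative along the curve has the sign of the main gap. -/
theorem exists_hasDerivAt_half (hp : Admissible x z) :
    ∃ r > 0, HasDerivAt (curveEdge x z) (r * mainGap x z) (x / 2) := by
  have hpi := pi_pos
  have hz : 0 < sin z := sin_pos_of_pos_of_lt_pi hp.z_pos (by linarith [hp.z_le])
  have hs : 0 < sin x := sin_pos_of_pos_of_lt_pi (by linarith [hp.z_pos, hp.z_lt])
    (by linarith [hp.x_le])
  have hc : 0 ≤ cos x := cos_nonneg_of_mem_Icc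
    ⟨by linarith [hp.z_pos, hp.z_lt], by linarith [hp.x_le]⟩
  have hc1 : 0 < 1 + cos x := by linarith
  have h1 : cos z < 1 := by
    rw [← cos_zero]
    exact cos_lt_cos_of_nonneg_of_le_pi le_rfl (by linarith [hp.z_le]) hp.z_pos
  have h2 : -1 < cos z := by
    have := cos_pos_of_mem_Ioo (x := z) ⟨by linarith [hp.z_pos], by linarith [hp.z_le]⟩
    linarith
  refine ⟨2 * sin x / (sin z * (1 + cos x)), by positivity, ?_⟩
  have h := hasDerivAt_curveEdge (x := x) (z := z) (w := x / 2)
    (by rwa [curveCos_half]) (by rwa [curveCos_half])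
  rw [hp.curveδ_half, jac_half, show 2 * (x / 2) - (x - z) = z by ring] at h
  refine h.congr_deriv ?_
  have h3 := sin_sq_add_cos_sq x
  field_simp
  rw [mainGap]
  linear_combination (cos (2 * z) - 1) * h3

theorem leftEnd_eq_half (hz : 2 * z ≤ x) : leftEnd x z = x / 2 :=
  max_eq_right (by linarith)

/-- At the right end `δ = (x - z) / 2`, and `redEdge₁` is `sin δ (sin w - sin (x + z - w))`. -/
theorem curveEdge_neg_rightEnd (hp : Admissible x z) {r : ℝ} (h0 : leftEnd x z < r)
    (hr : 2 * r < x + z) (hc : curveCos x z r = 1) : curveEdge x z r < 0 := by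
  have hpi := pi_pos
  have h1 : x / 2 < r := (le_max_right _ _).trans_lt h0
  have h2 := sin_lt_sin_sub (S := x + z) (w := r) (by linarith [hp.z_pos, hp.z_lt]) hr
    (by linarith [hp.x_le, hp.z_le])
  have hd : curveδ x z r = (x - z) / 2 := by rw [curveδ, hc, arccos_one, add_zero]
  have h3 : 0 < sin ((x - z) / 2) := sin_pos_of_pos_of_lt_pi (by linarith [hp.z_lt])
    (by linarith [hp.x_le, hp.z_pos])
  rw [curveEdge, hd, redEdge₁, show 3 * ((x - z) / 2) - (x - z) = (x - z) / 2 by ring]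
  have := mul_lt_mul_of_pos_left h2 h3
  linarith

theorem curveEdge_neg_of_nonpos (hp : Admissible x z) {p q : ℝ} (h1 : InCurve x z p)
    (h2 : InCurve x z q) (hpq : p < q) (h : curveEdge x z p ≤ 0) : curveEdge x z q < 0 := by
  obtain ⟨r, -, -, -, hr⟩ := hp.exists_rightEnd
  exact neg_of_nonpos_of_deriv_neg (continuous_curveEdge x z)
    (fun t ht h0 => ((hr t).2 ⟨ht.1, ht.2⟩).hasDerivAt_neg hp h0)
    h1.left_lt hpq ((hr q).1 h2).2 h

theorem zero_unique (hp : Admissible x z) {p q : ℝ} (h1 : InCurve x z p) (h2 : InCurve x z q)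
    (hp0 : curveEdge x z p = 0) (hq0 : curveEdge x z q = 0) : p = q := by
  rcases lt_trichotomy p q with h | h | h
  · exact absurd hq0 (hp.curveEdge_neg_of_nonpos h1 h2 h hp0.le).ne
  · exact h
  · exact absurd hp0 (hp.curveEdge_neg_of_nonpos h2 h1 h hq0.le).ne

/-- If `x < 2 z`, then the curve starts at `w = (x + z) / 3`, `δ = x - z`, where the edge function
is positive; otherwise it initially increases from its value `0` at the left end. -/
theorem exists_zero (hp : Admissible x z) (hm : 0 < mainGap x z) :
    ∃ w, InCurve x z w ∧ curveEdge x z w = 0 := by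
  have hpi := pi_pos
  obtain ⟨r, h1, h2, h3, hr⟩ := hp.exists_rightEnd
  have hneg := hp.curveEdge_neg_rightEnd h1 h2 h3
  obtain ⟨y, hy0, hy⟩ : ∃ y ∈ Ioo (leftEnd x z) r, 0 < curveEdge x z y := by
    rcases le_or_gt (2 * z) x with hz | hz
    · obtain ⟨c, hc, hd⟩ := hp.exists_hasDerivAt_half
      have hev := eventually_neg_right hd.neg (by simp [hp.curveEdge_half])
        (neg_neg_of_pos (mul_pos hc hm))
      rw [leftEnd_eq_half hz] at h1 ⊢
      obtain ⟨y, h4, h5⟩ := (hev.and (Ioo_mem_nhdsGT h1)).exists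
      exact ⟨y, h5, by simpa using h4⟩
    · have hl : leftEnd x z = (x + z) / 3 := max_eq_left (by linarith)
      have hpos : 0 < curveEdge x z (leftEnd x z) := by
        have hD : curveδ x z ((x + z) / 3) = x - z := by
          rw [curveδ, curveCos_third, arccos_cos (by linarith [hp.z_lt])
            (by linarith [hp.x_le, hp.z_pos])]
          ring
        have e1 : cos ((x + z) / 3) < cos (x - z) :=
          cos_lt_cos_of_nonneg_of_le_pi (by linarith [hp.z_lt])
            (by linarith [hp.x_le, hp.z_le]) (by linarith)
        have e2 : 0 < sin (x - z) := sin_pos_of_pos_of_lt_pi (by linarith [hp.z_lt])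
          (by linarith [hp.x_le, hp.z_pos])
        have e3 : 0 < sin ((x + z) / 3) := sin_pos_of_pos_of_lt_pi
          (by linarith [hp.z_pos, hp.z_lt]) (by linarith [hp.x_le, hp.z_le])
        have e4 : redEdge₁ (x + z) (x - z) ((x + z) / 3) (x - z) =
            2 * sin (x - z) * sin ((x + z) / 3) * (cos (x - z) - cos ((x + z) / 3)) := by
          rw [redEdge₁, show 3 * (x - z) - (x - z) = 2 * (x - z) by ring,
            show x + z - (x + z) / 3 = 2 * ((x + z) / 3) by ring, sin_two_mul, sin_two_mul]
          ring
        rw [hl, curveEdge, hD, e4]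
        have := sub_pos.2 e1
        positivity
      have hev : ∀ᶠ y in 𝓝[>] (leftEnd x z), 0 < curveEdge x z y :=
        ((continuous_curveEdge x z).continuousAt.eventually (Ioi_mem_nhds hpos)).filter_mono
          nhdsWithin_le_nhds
      obtain ⟨y, h4, h5⟩ := (hev.and (Ioo_mem_nhdsGT h1)).exists
      exact ⟨y, h5, h4⟩
  obtain ⟨w, hw, hw0⟩ := intermediate_value_Ioo' hy0.2.le
    (continuous_curveEdge x z).continuousOn ⟨hneg, hy⟩
  exact ⟨w, (hr w).2 ⟨hy0.1.trans hw.1, hw.2⟩, hw0⟩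

theorem curveEdge_neg_of_mainGap_neg (hp : Admissible x z) (hm : mainGap x z < 0) {w : ℝ}
    (hw : InCurve x z w) : curveEdge x z w < 0 := by
  have hz : 2 * z ≤ x := by
    by_contra! hz
    exact (hp.mainGap_pos_of_le hz.le).not_gt hm
  obtain ⟨c, hc, hd⟩ := hp.exists_hasDerivAt_half
  have hev := eventually_neg_right hd hp.curveEdge_half (mul_neg_of_pos_of_neg hc hm)
  obtain ⟨r, -, -, -, hr⟩ := hp.exists_rightEnd
  have hwl := hw.left_lt
  rw [leftEnd_eq_half hz] at hwl
  obtain ⟨y, h1, h2⟩ := (hev.and (Ioo_mem_nhdsGT hwl)).exists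
  refine hp.curveEdge_neg_of_nonpos ((hr y).2 ⟨?_, ?_⟩) hw h2.2 h1.le
  · rw [leftEnd_eq_half hz]; exact h2.1
  · exact h2.2.trans ((hr w).1 hw).2

/-- In the borderline case `mainGap x z = 0` a slightly smaller `z` has `mainGap < 0`, whereas a
positive value of the edge function persists. -/
theorem mainGap_pos_of_zero (hp : Admissible x z) {w : ℝ} (hw : InCurve x z w)
    (h0 : curveEdge x z w = 0) : 0 < mainGap x z := by
  by_contra! hm
  rcases hm.lt_or_eq with hm | hm
  · exact (hp.curveEdge_neg_of_mainGap_neg hm hw).ne h0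
  have hz : 2 * z < x := by
    by_contra! hz
    exact (hp.mainGap_pos_of_le hz).ne' hm
  -- Left of its zero the edge function is positive.
  obtain ⟨y, hyl, hyw⟩ := exists_between hw.left_lt
  have hy : InCurve x z y := by
    obtain ⟨r, -, -, -, hr⟩ := hp.exists_rightEnd
    exact (hr y).2 ⟨hyl, hyw.trans ((hr w).1 hw).2⟩
  have hpos : 0 < curveEdge x z y := by
    by_contra! hle
    exact (hp.curveEdge_neg_of_nonpos hy hw hyw hle).ne h0
  have c1 : Continuous fun z' => curveCos x z' y := by unfold curveCos; fun_prop
  have ev1 : ∀ᶠ z' in 𝓝 z, curveCos x z' y < 1 :=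
    c1.continuousAt.eventually (Iio_mem_nhds hy.cos_lt)
  have ev2 : ∀ᶠ z' in 𝓝 z, 0 < curveEdge x z' y :=
    (continuous_curveEdge_right x y).continuousAt.eventually (Ioi_mem_nhds hpos)
  have ev3 : ∀ᶠ z' in 𝓝 z, 2 * y - x < z' :=
    Ioi_mem_nhds (by linarith [hy.lt_half])
  have ev := ((ev1.and (ev2.and ev3)).filter_mono nhdsWithin_le_nhds).and
    (Ioo_mem_nhdsLT hp.z_pos)
  obtain ⟨z', ⟨h1, h2, h3⟩, h4, h5⟩ := ev.exists
  have hp' : Admissible x z' := ⟨h4, h5.trans hp.z_lt, hp.x_le, h5.le.trans hp.z_le⟩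
  have hy' : InCurve x z' y := by
    refine ⟨?_, by linarith, h1⟩
    rw [leftEnd_eq_half (by linarith)]
    linarith [hy.half_lt]
  have := hp'.curveEdge_neg_of_mainGap_neg (by linarith [hp.mainGap_lt h4 h5 hz.le]) hy'
  linarith

end Admissible

/-! ### Proper solutions as zeros along the curve -/

theorem admissible_of_lt {a b : ℕ} (ha : 2 ≤ a) (hab : a < b) :
    Admissible (π / a) (π / b) := by
  have ha' : (2 : ℝ) ≤ a := by exact_mod_cast ha
  have hab' : (a : ℝ) < b := by exact_mod_cast hab
  have hb' : (3 : ℝ) ≤ b := by exact_mod_cast (by lia : 3 ≤ b)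
  have hpi := pi_pos
  refine ⟨by positivity, ?_, ?_, ?_⟩ <;> gcongr

/-- The cases in which different bounds of `InRegion` are automatic. -/
theorem parameter_cases {a b : ℕ} (ha : 2 ≤ a) (hab : a < b) :
    (π / a ≤ π / 3 ∧ π / b ≤ π / 4) ∨
      π / a = π / 2 ∧ (π / b = π / 3 ∨ π / b ≤ π / 4) := by
  have hpi := pi_pos
  have h4 : 4 ≤ b → π / b ≤ π / 4 := fun h => by
    have : (4 : ℝ) ≤ b := by exact_mod_cast h
    gcongr
  rcases ha.eq_or_lt with rfl | ha
  · refine Or.inr ⟨by norm_num, ?_⟩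
    rcases (show 3 ≤ b from hab).eq_or_lt with rfl | hb
    · exact Or.inl (by norm_num)
    · exact Or.inr (h4 hb)
  · refine Or.inl ⟨?_, h4 (by lia)⟩
    have : (3 : ℝ) ≤ a := by exact_mod_cast ha
    gcongr

theorem det_halfAngles_neg_iff {x z u v : ℝ} (hu : 0 < u) (hu' : 2 * u < x) (hx : x ≤ π / 2)
    (hv : 0 < v) (hv' : 2 * v < z) (hz : z ≤ π / 2) :
    (coxeterSchlafli (halfAngles x z u v)).det < 0 ↔
      0 < (1 + cos (2 * (z - 2 * v))) * (1 + cos (2 * (x - 2 * u))) -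
        (cos (2 * u) - cos (2 * v)) ^ 2 := by
  have h := symmetric_part_neg hu hu' hx hv hv' hz
  rw [det_coxeterSchlafli]
  exact ⟨fun h' => pos_of_mul_neg_right h' h.le, fun h' => mul_neg_of_neg_of_pos h h'⟩

/-- In a proper solution both vertex triangles are hyperbolic triangles. -/
theorem inRegion_of_proper {x z u v : ℝ} (hp : Admissible x z)
    (hc : (x ≤ π / 3 ∧ z ≤ π / 4) ∨ x = π / 2 ∧ (z = π / 3 ∨ z ≤ π / 4))
    (hu : 0 < u) (hu' : 2 * u < x) (hv : 0 < v) (hv' : 2 * v < z)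
    (h₁ : f₁ (halfAngles x z u v) = 0) (h₂ : f₂ (halfAngles x z u v) = 0)
    (hα : triangleDet (cos (2 * u)) (cos (2 * (x - 2 * u))) (cos (2 * v)) < 0)
    (hβ : triangleDet (cos (2 * u)) (cos (2 * v)) (cos (2 * (z - 2 * v))) < 0)
    (hdet : (coxeterSchlafli (halfAngles x z u v)).det < 0) : InRegion x z u v := by
  have hpi := pi_pos
  have hz3 := hp.z_le
  rw [det_halfAngles_neg_iff hu hu' hp.x_le hv hv' (by linarith)] at hdet
  refine ⟨hu, hu', hv, hv', hp.x_le, by linarith, ?_, ?_⟩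
  · rcases hc with ⟨h3, h4⟩ | ⟨rfl, -⟩
    · linarith
    · linarith [sub_lt_pi_div_two_of_edge hu hv hv' hz3 h₁ h₂ hα hdet]
  · rcases hc with ⟨h3, h4⟩ | ⟨rfl, rfl | h4⟩
    · linarith
    · exact add_lt_pi_div_two_of_edge hu' hv h₂ hβ
    · linarith

/-- The antisymmetric part of the Coxeter–Schläfli form is positive definite when `β₁ < α₁`. -/
theorem antisymmetric_part_pos {x z u v : ℝ} (hp : Admissible x z) (hu' : 2 * u < x)
    (hv : 0 < v) (hv' : 2 * v < z) (huv : v < u) :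
    0 < (1 + cos (2 * (z - 2 * v))) * (1 + cos (2 * (x - 2 * u))) -
      (cos (2 * u) - cos (2 * v)) ^ 2 := by
  have hpi := pi_pos
  obtain ⟨hz0, hzx, hx, hz3⟩ := hp
  have hB : 1 / 2 < cos (z - 2 * v) := by
    rw [← cos_pi_div_three]
    exact cos_lt_cos_of_nonneg_of_le_pi (by linarith) (by linarith) (by linarith)
  have hs : 0 < sin (2 * u) := sin_pos_of_pos_of_lt_pi (by linarith) (by linarith)
  have hA : sin (2 * u) ≤ cos (x - 2 * u) := by
    rw [← cos_pi_div_two_sub]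
    exact cos_le_cos_of_nonneg_of_le_pi (by linarith) (by linarith) (by linarith)
  have hX : 0 < cos (2 * u) := cos_pos_of_mem_Ioo ⟨by linarith, by linarith⟩
  have hXY : cos (2 * u) < cos (2 * v) :=
    cos_lt_cos_of_nonneg_of_le_pi (by linarith) (by linarith) (by linarith)
  have hY : cos (2 * v) ≤ 1 := cos_le_one _
  have hsq := sin_sq_add_cos_sq (2 * u)
  have h1 : cos (2 * v) - cos (2 * u) < 2 * cos (z - 2 * v) * cos (x - 2 * u) := by
    have e1 : 1 - cos (2 * u) ≤ sin (2 * u) := by nlinarith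
    nlinarith
  have h2 : (cos (2 * v) - cos (2 * u)) ^ 2 < (2 * cos (z - 2 * v) * cos (x - 2 * u)) ^ 2 :=
    pow_lt_pow_left₀ h1 (by linarith) two_ne_zero
  rw [cos_two_mul (z - 2 * v), cos_two_mul (x - 2 * u)]
  linarith

theorem isProperSolution_iff {a b : ℕ} (ha : 2 ≤ a) (hab : a < b) (θ : Angles) :
    IsProperSolution a b θ ↔ ∃ w, InCurve (π / a) (π / b) w ∧ curveEdge (π / a) (π / b) w = 0 ∧
      θ = halfAngles (π / a) (π / b) ((w + curveδ (π / a) (π / b) w) / 2)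
        ((w - curveδ (π / a) (π / b) w) / 2) := by
  have hp := admissible_of_lt ha hab
  have hc := parameter_cases ha hab
  have hpi := pi_pos
  have ex : 2 * π / a = 2 * (π / a) := by ring
  have ez : 2 * π / b = 2 * (π / b) := by ring
  constructor
  · rintro ⟨⟨s1, s2, h₁, h₂⟩, p1, p2, p3, p4, hyp, out⟩
    rw [ex] at s1
    rw [ez] at s2
    generalize π / (a : ℝ) = x at *
    generalize π / (b : ℝ) = z at *
    obtain ⟨α₁, α₂, β₁, β₂⟩ := θ
    simp only at s1 s2 p1 p2 p3 p4
    obtain ⟨u, rfl⟩ : ∃ u, α₁ = 2 * u := ⟨α₁ / 2, by ring⟩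
    obtain ⟨v, rfl⟩ : ∃ v, β₁ = 2 * v := ⟨β₁ / 2, by ring⟩
    obtain rfl : α₂ = 2 * (x - 2 * u) := by linarith
    obtain rfl : β₂ = 2 * (z - 2 * v) := by linarith
    rw [verticesOutOfAbsolute_iff] at out
    have hr : InRegion x z u v := inRegion_of_proper hp hc (by linarith) (by linarith)
      (by linarith) (by linarith) h₁ h₂ out.1 out.2 ((isHyperbolic_iff _).1 hyp)
    obtain ⟨r₁, r₂⟩ := hr.edge_iff.1 ⟨h₁, h₂⟩
    obtain ⟨k1, k2, k3⟩ := (inCore_iff hp).1 ⟨hr.inCore hp r₁ r₂, r₁, r₂⟩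
    refine ⟨u + v, k1, k2, ?_⟩
    rw [← k3, show (u + v + (u - v)) / 2 = u by ring, show (u + v - (u - v)) / 2 = v by ring]
    rfl
  · rintro ⟨w, hw, h0, rfl⟩
    obtain ⟨hcore, r₁, r₂⟩ := (inCore_iff hp).2 ⟨hw, h0, rfl⟩
    suffices H : ∀ u v, u = (w + curveδ (π / a) (π / b) w) / 2 →
        v = (w - curveδ (π / a) (π / b) w) / 2 →
        IsProperSolution a b (halfAngles (π / a) (π / b) u v) from H _ _ rfl rfl
    intro u v hu hv
    have ew : w = u + v := by rw [hu, hv]; ring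
    have eδ : curveδ (π / a) (π / b) w = u - v := by rw [hu, hv]; ring
    rw [eδ, ew] at hcore r₁ r₂
    have hr := hcore.inRegion hp r₂
    have huv : v < u := hr.lt_of_redEdge hp r₁ r₂
    obtain ⟨h₁, h₂⟩ := hr.edge_iff.2 ⟨r₁, r₂⟩
    refine ⟨⟨?_, ?_, h₁, h₂⟩, ?_, ?_, ?_, ?_, ?_, ?_⟩
    · simp only [halfAngles]; ring
    · simp only [halfAngles]; ring
    · simp only [halfAngles]; linarith [hr.u_pos]
    · simp only [halfAngles]; linarith [hr.u_lt]
    · simp only [halfAngles]; linarith [hr.v_pos]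
    · simp only [halfAngles]; linarith [hr.v_lt]
    · rw [isHyperbolic_iff, det_halfAngles_neg_iff hr.u_pos hr.u_lt hr.x_le hr.v_pos hr.v_lt
        hr.z_le]
      exact antisymmetric_part_pos hp hr.u_lt hr.v_pos hr.v_lt huv
    · rw [verticesOutOfAbsolute_iff]
      exact ⟨hr.triangleDet_α_neg, hr.triangleDet_β_neg⟩

theorem mainInequality_iff (a b : ℕ) : MainInequality a b ↔ 0 < mainGap (π / a) (π / b) := by
  rw [MainInequality, mainGap, sub_pos, show 2 * (π / (b : ℝ)) = 2 * π / b by ring]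

/-- At the degenerate angles `α₁ = π / a`, `β₁ = 0` the second edge function is the difference of
the squares of the two sides of the main inequality. -/
theorem f₂_anglesOf (a b : ℕ) : f₂ (anglesOf a b (π / a) 0) =
    ((1 + cos (π / a)) * sin (2 * π / b)) ^ 2 -
      ((cos (π / a) + cos (2 * π / b)) * sin (π / a)) ^ 2 := by
  rw [f₂_eq]
  simp only [anglesOf]
  rw [show 2 * π / (a : ℝ) - 2 * (π / a) = 0 by ring, mul_zero, sub_zero, cos_zero]
  ring

theorem mainInequality_iff_f₂_pos {a b : ℕ} (ha : 2 ≤ a) (hab : a < b) :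
    MainInequality a b ↔ 0 < f₂ (anglesOf a b (π / a) 0) := by
  have hpi := pi_pos
  obtain ⟨hz0, hzx, hx, hz3⟩ := admissible_of_lt ha hab
  have ez : 2 * π / b = 2 * (π / b) := by ring
  rw [f₂_anglesOf, MainInequality, sub_pos, ez, gt_iff_lt, sq_lt_sq]
  generalize π / (a : ℝ) = x at *
  generalize π / (b : ℝ) = z at *
  have hc : 0 ≤ cos x := cos_nonneg_of_mem_Icc ⟨by linarith, by linarith⟩
  have hs : 0 < sin x := sin_pos_of_pos_of_lt_pi (by linarith) (by linarith)
  have hs2 : 0 < sin (2 * z) := sin_pos_of_pos_of_lt_pi (by linarith) (by linarith)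
  have hpos : 0 < (1 + cos x) * sin (2 * z) := by positivity
  rw [abs_of_pos hpos, abs_lt]
  refine ⟨fun h => ⟨?_, h⟩, fun h => h.2⟩
  -- The right-hand side is negative only if `z > π / 4`, and then it is small.
  rcases le_or_gt 0 (cos x + cos (2 * z)) with h0 | h0
  · have := mul_nonneg h0 hs.le
    linarith
  · have h1 : cos (2 * z) < 0 := by linarith
    have h2 : -(1 / 2) ≤ cos (2 * z) := by
      rw [← cos_pi_div_three, ← cos_pi_sub]
      exact cos_le_cos_of_nonneg_of_le_pi (by linarith) (by linarith) (by linarith)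
    have h3 : 1 / 2 < sin (2 * z) := by nlinarith [sin_sq_add_cos_sq (2 * z)]
    have h4 := sin_le_one x
    nlinarith

end SimplexT

theorem theorem1 (a b : ℕ) (ha : 2 ≤ a) (hab : a < b) :
    (SimplexT.RealizableOuter a b ↔ SimplexT.MainInequality a b) ∧
    (SimplexT.MainInequality a b ↔ 0 < SimplexT.f₂ (SimplexT.anglesOf a b (Real.pi / a) 0)) ∧
    (SimplexT.MainInequality a b → ∃! θ : SimplexT.Angles, SimplexT.IsProperSolution a b θ) := by
  have hp := SimplexT.admissible_of_lt ha hab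
  have key : SimplexT.MainInequality a b →
      ∃! θ : SimplexT.Angles, SimplexT.IsProperSolution a b θ := by
    intro h
    obtain ⟨w, hw, h0⟩ := hp.exists_zero ((SimplexT.mainInequality_iff a b).1 h)
    refine ⟨_, (SimplexT.isProperSolution_iff ha hab _).2 ⟨w, hw, h0, rfl⟩, ?_⟩
    intro θ hθ
    obtain ⟨w', hw', h0', rfl⟩ := (SimplexT.isProperSolution_iff ha hab θ).1 hθ
    rw [hp.zero_unique hw hw' h0 h0']
  refine ⟨⟨?_, fun h => (key h).exists⟩, SimplexT.mainInequality_iff_f₂_pos ha hab, key⟩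
  rintro ⟨θ, hθ⟩
  obtain ⟨w, hw, h0, -⟩ := (SimplexT.isProperSolution_iff ha hab θ).1 hθ
  exact (SimplexT.mainInequality_iff a b).2 (hp.mainGap_pos_of_zero hw h0)
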